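/- A $3$-uniform hypergraph is identified with the simplicial complex formed by all subsets of its edges; it is a triangulation of a topological space $X$ if the geometric realization of this complex is homeomorphic to $X$. A topological cycle is a $3$-uniform hypergraph $\mathcal{C}$ that is a triangulation of the cylinder $S^1\times[0,1]$ or of the Möbius strip such that every vertex of $\mathcal{C}$ lies on the boundary; its length is its number of edges. A topological cycle $\mathcal{C}$ is torus-like if either $\mathcal{C}$ has an even number of edges and is a triangulation of the cylinder, or $\mathcal{C}$ has an odd number of edges and is a triangulation of the Möbius strip. Theorem. Let $k\ge 2$ be an integer. If $\mathcal{H}$ is a $3$-uniform hypergraph on $n$ vertices which contains no torus-like topological cycle of length at most $6k$ as a subhypergraph, then $\mathcal{H}$ has at most $n^{2+\frac{2}{k-1}+o(1)}$ edges. Here $o(1)$ denotes a quantity $\delta_k(n)$, depending only on $k$ and $n$, with $\delta_k(n)\to 0$ as $n\to\infty$ for fixed $k$. -/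

import Mathlib

/-- The topological space of a finite hypergraph with edge set `C`: the geometric realization of
the simplicial complex formed by the subsets of the edges. A point is given by its barycentric
coordinates, and its support lies in an edge. -/
def realization {V : Type*} [Fintype V] (C : Finset (Finset V)) : Set (V → ℝ) :=
  {x | x ∈ stdSimplex ℝ V ∧ ∃ e ∈ C, ∀ v, v ∉ e → x v = 0}

/-- The cylinder `S¹ × [0, 1]`. -/
abbrev Cylinder : Type := Circle × unitInterval

/-- The boundary `S¹ × {0, 1}` of the cylinder. -/
def cylinderBoundary : Set Cylinder := {p | p.2 = 0 ∨ p.2 = 1}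

/-- The gluing `(0, t) ∼ (1, 1 - t)` of two opposite sides of the square. -/
inductive MobiusRel : unitInterval × unitInterval → unitInterval × unitInterval → Prop
  | glue (t : unitInterval) : MobiusRel (0, t) (1, unitInterval.symm t)

/-- The Möbius strip, with the quotient topology. -/
abbrev MobiusStrip : Type := Quot MobiusRel

/-- The boundary of the Möbius strip: the image of the two sides that are not glued. -/
def mobiusBoundary : Set MobiusStrip := {q | ∃ s t, (t = 0 ∨ t = 1) ∧ q = Quot.mk _ (s, t)}

/-- `C` triangulates the space `S` in such a way that every vertex of `C` lies on `B`
(the vertices of the realization are the points with a barycentric coordinate equal to `1`). -/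
def TriangulatesWithVerticesOn {V : Type*} [Fintype V] (C : Finset (Finset V))
    (S : Type) [TopologicalSpace S] (B : Set S) : Prop :=
  ∃ φ : realization C ≃ₜ S, ∀ (x : realization C) (v : V), x.1 v = 1 → φ x ∈ B

/-- A topological cycle that is a cylinder. -/
def IsCylinderCycle {V : Type*} [Fintype V] (C : Finset (Finset V)) : Prop :=
  (C : Set (Finset V)).Sized 3 ∧ TriangulatesWithVerticesOn C Cylinder cylinderBoundary

/-- A topological cycle that is a Möbius strip. -/
def IsMobiusCycle {V : Type*} [Fintype V] (C : Finset (Finset V)) : Prop :=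
  (C : Set (Finset V)).Sized 3 ∧ TriangulatesWithVerticesOn C MobiusStrip mobiusBoundary

/-- A topological cycle: a 3-uniform hypergraph, given by its edge set, that triangulates the
cylinder or the Möbius strip with all vertices on the boundary. Its length is `C.card`. -/
def IsTopologicalCycle {V : Type*} [Fintype V] (C : Finset (Finset V)) : Prop :=
  IsCylinderCycle C ∨ IsMobiusCycle C

/-- A topological cycle is torus-like if it has an even number of edges and is a cylinder, or has
an odd number of edges and is a Möbius strip. -/
def IsTorusLike {V : Type*} [Fintype V] (C : Finset (Finset V)) : Prop :=
  IsTopologicalCycle C ∧ ((Even C.card ∧ IsCylinderCycle C) ∨ (Odd C.card ∧ IsMobiusCycle C))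

/-! A random walk that glues strips of triangles produces triangulated cylinders, and a trace
estimate shows that some closed walk repeats no vertex.

A state is an ordered pair `(x, y)`. A step picks `c`, `v`, `u` with `xyc`, `ycv`, `cvu` edges, each
choice after `c` being uniform, and arrives at `(u, v)`. A closed walk with `2j ≥ 4` steps and no
vertex repeated between different steps is a triangulated cylinder with `6j` edges, hence torus-like
(`exists_isTorusLike_of_walk`). So in a hypergraph without such cycles every closed walk of length
`2j`, `2 ≤ j ≤ k`, has a conflict: two different steps contribute a common vertex.

After passing to a subhypergraph in which every pair in an edge has codegree at least `D`
(`exists_subhypergraph_codegree_ge`), a prescribed vertex occurs in a given place of a step with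
probability at most `η = 1/D`. Let `M` be the symmetrically normalized step matrix. Cauchy–Schwarz
(`sum_trace_conflict_sq_le`) bounds the weight of the closed walks with a given conflict by `√(η ·
tr M^(2j) · tr M^(2j-2))`. Since all closed walks have conflicts, `tr M^(2j) ≤ A η · tr M^(2j-2)`
with `A` depending only on `k` (`trace_pow_le_of_forall_conflict`).

Iterating down to `tr M² ≤ n²` gives `tr M^(2k) ≤ (A/D)^(k-1) n²`. But `M` fixes a nonzero vector,
so `tr M^(2k) ≥ 1`. Hence `D` is at most of order `n^(2/(k-1))`, and `H` has at most of order `D n²`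
edges. -/

/-! ### Distances on the circle of length `m`. -/

section CylinderTriangulation

/-- The point of the circle of length `m` with integer coordinate `i`. -/
noncomputable def circlePoint (m : ℕ) : ZMod m →+ AddCircle (m : ℝ) :=
  ZMod.lift m ⟨(zmultiplesHom _) ((1 : ℝ) : AddCircle (m : ℝ)), by
    rw [zmultiplesHom_apply, ← AddCircle.coe_zsmul, AddCircle.coe_eq_zero_iff]
    exact ⟨1, by simp⟩⟩

theorem circlePoint_natCast (m a : ℕ) :
    circlePoint m (a : ZMod m) = ((a : ℝ) : AddCircle (m : ℝ)) := by
  rw [← Int.cast_natCast (R := ZMod m), circlePoint, ZMod.lift_coe]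
  change (zmultiplesHom _) ((1 : ℝ) : AddCircle (m : ℝ)) (a : ℤ) = _
  rw [zmultiplesHom_apply, ← AddCircle.coe_zsmul]
  simp

theorem circlePoint_one (m : ℕ) : circlePoint m 1 = ((1 : ℝ) : AddCircle (m : ℝ)) := by
  simpa using circlePoint_natCast m 1

theorem le_norm_addCircle {p a r : ℝ} (h : ∀ z : ℤ, a ≤ |r - z * p|) :
    a ≤ ‖(r : AddCircle p)‖ := by
  rw [AddCircle.norm_eq]
  exact h _

theorem exists_circlePoint_add {m : ℕ} (hm : 0 < m) (s : AddCircle (m : ℝ)) :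
    ∃ (i : ZMod m) (u : ℝ), 0 ≤ u ∧ u ≤ 1 ∧ s = circlePoint m i + (u : AddCircle (m : ℝ)) := by
  have : Fact (0 < (m : ℝ)) := ⟨by exact_mod_cast hm⟩
  obtain ⟨⟨r, hr⟩, rfl⟩ := (AddCircle.equivIco (m : ℝ) 0).symm.surjective s
  have h0 : 0 ≤ r := hr.1
  refine ⟨((⌊r⌋₊ : ℕ) : ZMod m), r - ⌊r⌋₊, ?_, ?_, ?_⟩
  · linarith [Nat.floor_le h0]
  · linarith [Nat.lt_floor_add_one r]
  · rw [circlePoint_natCast, ← AddCircle.coe_add]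
    change ((r : ℝ) : AddCircle (m : ℝ)) = _
    congr 1
    ring

section Distances

variable {m : ℕ} (hm : 3 ≤ m) (i : ZMod m) {u : ℝ} (hu0 : 0 ≤ u) (hu1 : u ≤ 1)
include hm hu0 hu1

/-- Since `u ≤ 1 ≤ m / 2`, the displacement is its own shortest representative modulo `m`. -/
theorem norm_add_sub_circlePoint_self :
    ‖circlePoint m i + (u : AddCircle (m : ℝ)) - circlePoint m i‖ = u := by
  have hm' : (3 : ℝ) ≤ m := by exact_mod_cast hm
  rw [add_sub_cancel_left, (AddCircle.norm_coe_eq_abs_iff _ (by positivity)).2, abs_of_nonneg hu0]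
  rw [abs_of_nonneg hu0, abs_of_nonneg (by positivity)]
  linarith

theorem norm_add_sub_circlePoint_succ :
    ‖circlePoint m i + (u : AddCircle (m : ℝ)) - circlePoint m (i + 1)‖ = 1 - u := by
  have hm' : (3 : ℝ) ≤ m := by exact_mod_cast hm
  rw [map_add, circlePoint_one, add_sub_add_left_eq_sub, ← AddCircle.coe_sub,
    (AddCircle.norm_coe_eq_abs_iff _ (by positivity)).2]
  · rw [abs_of_nonpos (by linarith)]; ring
  · rw [abs_of_nonpos (by linarith), abs_of_nonneg (by positivity)]
    linarith

theorem norm_add_sub_circlePoint_half :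
    ‖circlePoint m i + (u : AddCircle (m : ℝ)) -
      (circlePoint m i + ((1 / 2 : ℝ) : AddCircle (m : ℝ)))‖ = |u - 1 / 2| := by
  have hm' : (3 : ℝ) ≤ m := by exact_mod_cast hm
  rw [add_sub_add_left_eq_sub, ← AddCircle.coe_sub,
    (AddCircle.norm_coe_eq_abs_iff _ (by positivity)).2]
  rw [abs_of_nonneg (by positivity : (0 : ℝ) ≤ m)]
  have : |u - 1 / 2| ≤ 1 / 2 := abs_le.2 ⟨by linarith, by linarith⟩
  linarith

theorem le_norm_add_sub_circlePoint_half {j : ZMod m} (hj : j ≠ i) :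
    1 / 2 ≤ ‖circlePoint m i + (u : AddCircle (m : ℝ)) -
      (circlePoint m j + ((1 / 2 : ℝ) : AddCircle (m : ℝ)))‖ := by
  have : NeZero m := ⟨by omega⟩
  have hk0 : (j - i).val ≠ 0 := by rw [Ne, ZMod.val_eq_zero, sub_eq_zero]; exact hj
  have hkm : (j - i).val < m := ZMod.val_lt _
  have hj' : circlePoint m j = circlePoint m i + (((j - i).val : ℝ) : AddCircle (m : ℝ)) := by
    rw [← circlePoint_natCast, ← map_add]; simp
  generalize (j - i).val = κ at *
  have h1 : (1 : ℝ) ≤ κ := by exact_mod_cast Nat.one_le_iff_ne_zero.2 hk0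
  have h2 : (κ : ℝ) + 1 ≤ m := by exact_mod_cast hkm
  rw [hj', add_assoc, add_sub_add_left_eq_sub, ← AddCircle.coe_add, ← AddCircle.coe_sub]
  apply le_norm_addCircle
  intro z
  rcases le_or_gt 0 z with hz | hz
  · have : (0 : ℝ) ≤ z * m := mul_nonneg (by exact_mod_cast hz) (by positivity)
    rw [abs_of_nonpos] <;> linarith
  · have hz' : (z : ℝ) ≤ -1 := by exact_mod_cast (by omega : z ≤ -1)
    have : (z : ℝ) * m ≤ -m := by nlinarith [(by positivity : (0 : ℝ) ≤ m)]
    rw [abs_of_nonneg] <;> linarith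

/-- Write `j = i + κ` with `2 ≤ κ ≤ m - 1`. Then `u - κ` lies in `[-(m - 1), -1]`, and no translate
of this interval by a multiple of `m` comes closer to `0` than `1`. -/
theorem one_le_norm_add_sub_circlePoint {j : ZMod m} (hj : j ≠ i) (hj1 : j ≠ i + 1) :
    1 ≤ ‖circlePoint m i + (u : AddCircle (m : ℝ)) - circlePoint m j‖ := by
  have : NeZero m := ⟨by omega⟩
  have hk0 : (j - i).val ≠ 0 := by rw [Ne, ZMod.val_eq_zero, sub_eq_zero]; exact hj
  have hk1 : (j - i).val ≠ 1 := by
    intro h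
    have h' : (((j - i).val : ℕ) : ZMod m) = 1 := by rw [h]; simp
    rw [ZMod.natCast_zmod_val, sub_eq_iff_eq_add] at h'
    exact hj1 (h'.trans (add_comm _ _))
  have hkm : (j - i).val < m := ZMod.val_lt _
  have hj' : circlePoint m j = circlePoint m i + (((j - i).val : ℝ) : AddCircle (m : ℝ)) := by
    rw [← circlePoint_natCast, ← map_add]; simp
  generalize (j - i).val = κ at *
  have h1 : (2 : ℝ) ≤ κ := by exact_mod_cast (by omega : 2 ≤ κ)
  have h2 : (κ : ℝ) + 1 ≤ m := by exact_mod_cast hkm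
  rw [hj', add_sub_add_left_eq_sub, ← AddCircle.coe_sub]
  apply le_norm_addCircle
  intro z
  rcases le_or_gt 0 z with hz | hz
  · have : (0 : ℝ) ≤ z * m := mul_nonneg (by exact_mod_cast hz) (by positivity)
    rw [abs_of_nonpos] <;> linarith
  · have hz' : (z : ℝ) ≤ -1 := by exact_mod_cast (by omega : z ≤ -1)
    have : (z : ℝ) * m ≤ -m := by nlinarith [(by positivity : (0 : ℝ) ≤ m)]
    rw [abs_of_nonneg] <;> linarith

end Distances

/-! ### Barycentric coordinates on the cylinder. -/

/-- The barycentric coordinates of the point `(s, t)` of the cylinder of circumference `m` in the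
triangulation whose vertices are `(i, 0)`, `(i, 1)` and `(i + 1/2, 0)`, in this order. -/
noncomputable def cylinderWeight {m : ℕ} (κ : Fin 3) (i : ZMod m) (s : AddCircle (m : ℝ))
    (t : ℝ) : ℝ :=
  ![max 0 (1 - t - 2 * ‖s - circlePoint m i‖),
    max 0 (min t ((1 + t) / 2 - ‖s - circlePoint m i‖)),
    max 0 (min (1 - t) (1 - 2 * ‖s - (circlePoint m i + ((1 / 2 : ℝ) : AddCircle (m : ℝ)))‖))] κ

theorem cylinderWeight_nonneg {m : ℕ} (κ : Fin 3) (i : ZMod m) (s : AddCircle (m : ℝ)) (t : ℝ) :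
    0 ≤ cylinderWeight κ i s t := by
  fin_cases κ <;> simp [cylinderWeight]

theorem continuous_cylinderWeight {m : ℕ} (κ : Fin 3) (i : ZMod m) :
    Continuous fun p : AddCircle (m : ℝ) × ℝ => cylinderWeight κ i p.1 p.2 := by
  fin_cases κ <;> simp only [cylinderWeight] <;> simp <;> fun_prop

section Weights

variable {m : ℕ} (hm : 3 ≤ m) (i : ZMod m) {u t : ℝ} (hu0 : 0 ≤ u) (hu1 : u ≤ 1)
  (ht0 : 0 ≤ t) (ht1 : t ≤ 1)
include hm hu0 hu1

theorem cylinderWeight_zero_self : cylinderWeight 0 i (circlePoint m i + (u : AddCircle (m : ℝ))) t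
    = max 0 (1 - t - 2 * u) := by
  simp only [cylinderWeight, norm_add_sub_circlePoint_self hm i hu0 hu1, Matrix.cons_val_zero]

theorem cylinderWeight_zero_succ :
    cylinderWeight 0 (i + 1) (circlePoint m i + (u : AddCircle (m : ℝ))) t
    = max 0 (1 - t - 2 * (1 - u)) := by
  simp only [cylinderWeight, norm_add_sub_circlePoint_succ hm i hu0 hu1, Matrix.cons_val_zero]

theorem cylinderWeight_one_self : cylinderWeight 1 i (circlePoint m i + (u : AddCircle (m : ℝ))) t
    = max 0 (min t ((1 + t) / 2 - u)) := by
  simp only [cylinderWeight, norm_add_sub_circlePoint_self hm i hu0 hu1, Matrix.cons_val_one,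
    Matrix.cons_val_zero]

theorem cylinderWeight_one_succ :
    cylinderWeight 1 (i + 1) (circlePoint m i + (u : AddCircle (m : ℝ))) t
    = max 0 (min t ((1 + t) / 2 - (1 - u))) := by
  simp only [cylinderWeight, norm_add_sub_circlePoint_succ hm i hu0 hu1, Matrix.cons_val_one,
    Matrix.cons_val_zero]

theorem cylinderWeight_two_self : cylinderWeight 2 i (circlePoint m i + (u : AddCircle (m : ℝ))) t
    = max 0 (min (1 - t) (1 - 2 * |u - 1 / 2|)) := by
  simp only [cylinderWeight, norm_add_sub_circlePoint_half hm i hu0 hu1, Matrix.cons_val_two,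
    Matrix.tail_cons, Matrix.head_cons]

theorem cylinderWeight_two_of_ne {j : ZMod m} (hj : j ≠ i) :
    cylinderWeight 2 j (circlePoint m i + (u : AddCircle (m : ℝ))) t = 0 := by
  have := le_norm_add_sub_circlePoint_half hm i hu0 hu1 hj
  simp only [cylinderWeight, Matrix.cons_val_two, Matrix.tail_cons, Matrix.head_cons]
  exact max_eq_left ((min_le_right _ _).trans (by linarith))

include ht0

theorem cylinderWeight_zero_of_ne {j : ZMod m} (hj : j ≠ i) (hj1 : j ≠ i + 1) :
    cylinderWeight 0 j (circlePoint m i + (u : AddCircle (m : ℝ))) t = 0 := by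
  have := one_le_norm_add_sub_circlePoint hm i hu0 hu1 hj hj1
  simp only [cylinderWeight, Matrix.cons_val_zero]
  exact max_eq_left (by linarith)

omit ht0
include ht1

theorem cylinderWeight_one_of_ne {j : ZMod m} (hj : j ≠ i) (hj1 : j ≠ i + 1) :
    cylinderWeight 1 j (circlePoint m i + (u : AddCircle (m : ℝ))) t = 0 := by
  have := one_le_norm_add_sub_circlePoint hm i hu0 hu1 hj hj1
  simp only [cylinderWeight, Matrix.cons_val_one, Matrix.cons_val_zero]
  exact max_eq_left ((min_le_right _ _).trans (by linarith))

end Weights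

/-- The triangles of a triangulated cylinder with vertices `vert κ i`. -/
def cylinderTriangle {V : Type*} [DecidableEq V] {m : ℕ} (vert : Fin 3 → ZMod m → V)
    (κ : Fin 3) (i : ZMod m) : Finset V :=
  ![{vert 0 i, vert 1 i, vert 2 i}, {vert 1 i, vert 2 i, vert 1 (i + 1)},
    {vert 2 i, vert 1 (i + 1), vert 0 (i + 1)}] κ

/-- The edge set of a triangulated cylinder with vertices `vert κ i`. -/
def cylinderComplex {V : Type*} [DecidableEq V] {m : ℕ} [NeZero m] (vert : Fin 3 → ZMod m → V) :
    Finset (Finset V) :=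
  Finset.univ.image fun p : Fin 3 × ZMod m => cylinderTriangle vert p.1 p.2

/-- The point of the realization of a triangulated cylinder with cylindrical coordinates `s`
and `t`. -/
noncomputable def cylinderPoint {V : Type*} [DecidableEq V] {m : ℕ} [NeZero m]
    (vert : Fin 3 → ZMod m → V) (s : AddCircle (m : ℝ)) (t : ℝ) (v : V) : ℝ :=
  ∑ p : Fin 3 × ZMod m, if vert p.1 p.2 = v then cylinderWeight p.1 p.2 s t else 0

/-! ### The explicit homeomorphism between the cylinder and the complex. -/

section Realization

variable {V : Type*} [DecidableEq V] {m : ℕ} [NeZero m] {vert : Fin 3 → ZMod m → V}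

omit [NeZero m] in
theorem zmod_add_one_ne (hm : 3 ≤ m) (i : ZMod m) : i + 1 ≠ i := by
  have : Fact (1 < m) := ⟨by omega⟩
  simp

omit [NeZero m] in
theorem zmod_add_one_add_one_ne (hm : 3 ≤ m) (i : ZMod m) : i + 1 + 1 ≠ i := by
  intro h
  have h2 : ((2 : ℕ) : ZMod m) = 0 := by
    have : i + ((2 : ℕ) : ZMod m) = i + 0 := by
      rw [add_zero]
      refine Eq.trans ?_ h
      push_cast
      ring
    exact add_left_cancel this
  rw [ZMod.natCast_eq_zero_iff] at h2
  exact absurd (Nat.le_of_dvd (by norm_num) h2) (by omega)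

/-- The vertices with `κ = 1` are those at height `1`, so their total weight is the height. This
recovers `t` from the weights. -/
theorem sum_cylinderWeight_one (hm : 3 ≤ m) (s : AddCircle (m : ℝ)) {t : ℝ} (ht0 : 0 ≤ t)
    (ht1 : t ≤ 1) : ∑ i : ZMod m, cylinderWeight 1 i s t = t := by
  obtain ⟨i, u, hu0, hu1, rfl⟩ := exists_circlePoint_add (by omega) s
  rw [Fintype.sum_eq_add i (i + 1) (zmod_add_one_ne hm i).symm
      fun j hj => cylinderWeight_one_of_ne hm i hu0 hu1 ht1 hj.1 hj.2,
    cylinderWeight_one_self hm i hu0 hu1, cylinderWeight_one_succ hm i hu0 hu1]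
  grind

theorem sum_cylinderWeight (hm : 3 ≤ m) (s : AddCircle (m : ℝ)) {t : ℝ} (ht0 : 0 ≤ t)
    (ht1 : t ≤ 1) : ∑ p : Fin 3 × ZMod m, cylinderWeight p.1 p.2 s t = 1 := by
  rw [Fintype.sum_prod_type, Fin.sum_univ_three, sum_cylinderWeight_one hm s ht0 ht1]
  obtain ⟨i, u, hu0, hu1, rfl⟩ := exists_circlePoint_add (by omega) s
  rw [Fintype.sum_eq_add i (i + 1) (zmod_add_one_ne hm i).symm
      fun j hj => cylinderWeight_zero_of_ne hm i hu0 hu1 ht0 hj.1 hj.2,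
    Fintype.sum_eq_single i fun j hj => cylinderWeight_two_of_ne hm i hu0 hu1 hj,
    cylinderWeight_zero_self hm i hu0 hu1, cylinderWeight_zero_succ hm i hu0 hu1,
    cylinderWeight_two_self hm i hu0 hu1]
  rcases abs_cases (u - 1 / 2) with h | h <;> rw [h.1] <;> simp only [max_def, min_def] <;>
    split_ifs <;> linarith

theorem cylinderPoint_vert (hv : Function.Injective2 vert) (κ : Fin 3) (i : ZMod m)
    (s : AddCircle (m : ℝ)) (t : ℝ) :
    cylinderPoint vert s t (vert κ i) = cylinderWeight κ i s t := by
  rw [cylinderPoint, Fintype.sum_eq_single (κ, i)]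
  · simp
  · rintro ⟨κ', j⟩ h
    rw [if_neg]
    intro h'
    obtain ⟨rfl, rfl⟩ := hv h'
    exact h rfl

theorem cylinderPoint_eq_zero {s : AddCircle (m : ℝ)} {t : ℝ} {v : V}
    (h : ∀ κ i, vert κ i = v → cylinderWeight κ i s t = 0) : cylinderPoint vert s t v = 0 := by
  rw [cylinderPoint]
  refine Finset.sum_eq_zero fun p _ => ?_
  split_ifs with hp
  · exact h _ _ hp
  · rfl

theorem sum_cylinderPoint [Fintype V] (hm : 3 ≤ m) (s : AddCircle (m : ℝ)) {t : ℝ} (ht0 : 0 ≤ t)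
    (ht1 : t ≤ 1) : ∑ v, cylinderPoint vert s t v = 1 := by
  simp only [cylinderPoint]
  rw [Finset.sum_comm]
  simp [sum_cylinderWeight hm s ht0 ht1]

/-- The lines `u = (1 - t) / 2` and `u = (1 + t) / 2` join `(1/2, 0)` to `(0, 1)` and to `(1, 1)`.
They cut the sector `0 ≤ u ≤ 1` into the three triangles, numbered by `κ`. -/
theorem cylinderPoint_eq_zero_of_notMem (hm : 3 ≤ m) (i : ZMod m) {u t : ℝ} (hu0 : 0 ≤ u)
    (hu1 : u ≤ 1) (ht0 : 0 ≤ t) (ht1 : t ≤ 1) {κ : Fin 3}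
    (hκ : ![u ≤ (1 - t) / 2, (1 - t) / 2 ≤ u ∧ u ≤ (1 + t) / 2, (1 + t) / 2 ≤ u] κ) {v : V}
    (hv : v ∉ cylinderTriangle vert κ i) :
    cylinderPoint vert (circlePoint m i + (u : AddCircle (m : ℝ))) t v = 0 := by
  apply cylinderPoint_eq_zero
  rintro κ' j rfl
  by_cases hj : j = i
  · subst hj
    fin_cases κ <;> fin_cases κ' <;> simp [cylinderTriangle] at hv hκ ⊢
    · rw [cylinderWeight_zero_self hm j hu0 hu1]; grind
    · rw [cylinderWeight_zero_self hm j hu0 hu1]; grind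
    · rw [cylinderWeight_one_self hm j hu0 hu1]; grind
  by_cases hj1 : j = i + 1
  · subst hj1
    fin_cases κ <;> fin_cases κ' <;> simp [cylinderTriangle] at hv hκ ⊢
    · rw [cylinderWeight_zero_succ hm i hu0 hu1]; grind
    · rw [cylinderWeight_one_succ hm i hu0 hu1]; grind
    · exact cylinderWeight_two_of_ne hm i hu0 hu1 hj
    · rw [cylinderWeight_zero_succ hm i hu0 hu1]; grind
    · exact cylinderWeight_two_of_ne hm i hu0 hu1 hj
    · exact cylinderWeight_two_of_ne hm i hu0 hu1 hj
  fin_cases κ'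
  · exact cylinderWeight_zero_of_ne hm i hu0 hu1 ht0 hj hj1
  · exact cylinderWeight_one_of_ne hm i hu0 hu1 ht1 hj hj1
  · exact cylinderWeight_two_of_ne hm i hu0 hu1 hj

theorem cylinderPoint_mem_realization [Fintype V] (hm : 3 ≤ m) (s : AddCircle (m : ℝ)) {t : ℝ}
    (ht0 : 0 ≤ t) (ht1 : t ≤ 1) :
    cylinderPoint vert s t ∈ realization (cylinderComplex vert) := by
  refine ⟨⟨fun v => ?_, sum_cylinderPoint hm s ht0 ht1⟩, ?_⟩
  · exact Finset.sum_nonneg fun p _ => by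
      split_ifs
      · exact cylinderWeight_nonneg _ _ _ _
      · exact le_rfl
  obtain ⟨i, u, hu0, hu1, rfl⟩ := exists_circlePoint_add (by omega) s
  have key : ∃ κ : Fin 3,
      ![u ≤ (1 - t) / 2, (1 - t) / 2 ≤ u ∧ u ≤ (1 + t) / 2, (1 + t) / 2 ≤ u] κ := by
    rcases le_total u ((1 - t) / 2) with h | h
    · exact ⟨0, h⟩
    rcases le_total u ((1 + t) / 2) with h' | h'
    · exact ⟨1, h, h'⟩
    · exact ⟨2, h'⟩
  obtain ⟨κ, hκ⟩ := key
  refine ⟨cylinderTriangle vert κ i, Finset.mem_image_of_mem _ (Finset.mem_univ (κ, i)), ?_⟩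
  exact fun v hv => cylinderPoint_eq_zero_of_notMem hm i hu0 hu1 ht0 ht1 hκ hv

theorem eq_cylinderPoint_of_mem_realization [Fintype V] (hm : 3 ≤ m)
    (hv : Function.Injective2 vert) {z : V → ℝ} (hz : z ∈ realization (cylinderComplex vert)) :
    ∃ (s : AddCircle (m : ℝ)) (t : ℝ), 0 ≤ t ∧ t ≤ 1 ∧ cylinderPoint vert s t = z := by
  obtain ⟨⟨hz0, hz1⟩, e, he, hze⟩ := hz
  obtain ⟨⟨κ, i⟩, -, rfl⟩ := Finset.mem_image.1 he
  dsimp only at hze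
  rw [← Finset.sum_subset (Finset.subset_univ (cylinderTriangle vert κ i))
    fun v _ hv => hze v hv] at hz1
  have hne : ∀ κ κ' j j', (κ ≠ κ' ∨ j ≠ j') → vert κ j ≠ vert κ' j' := by
    intro κ κ' j j' h h'
    obtain ⟨rfl, rfl⟩ := hv h'
    simp at h
  have hi := zmod_add_one_ne hm i
  -- The witnesses `(u, t)` below are the averages, with weights `z`, of the vertex positions: `(0,
  -- 0)`, `(0, 1)`, `(1/2, 0)` for `vert 0 i`, `vert 1 i`, `vert 2 i`, and `(1, 0)`, `(1, 1)` for
  -- `vert 0 (i + 1)`, `vert 1 (i + 1)`.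
  suffices ∃ u t : ℝ, 0 ≤ u ∧ u ≤ 1 ∧ 0 ≤ t ∧ t ≤ 1 ∧
      ![u ≤ (1 - t) / 2, (1 - t) / 2 ≤ u ∧ u ≤ (1 + t) / 2, (1 + t) / 2 ≤ u] κ ∧
      ∀ v ∈ cylinderTriangle vert κ i,
        cylinderPoint vert (circlePoint m i + (u : AddCircle (m : ℝ))) t v = z v by
    obtain ⟨u, t, hu0, hu1, ht0, ht1, hκ, h⟩ := this
    refine ⟨circlePoint m i + (u : AddCircle (m : ℝ)), t, ht0, ht1, funext fun v => ?_⟩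
    by_cases hvt : v ∈ cylinderTriangle vert κ i
    · exact h v hvt
    · rw [cylinderPoint_eq_zero_of_notMem hm i hu0 hu1 ht0 ht1 hκ hvt, hze v hvt]
  fin_cases κ
  · simp only [cylinderTriangle, Fin.zero_eta, Matrix.cons_val_zero] at hz1 ⊢
    rw [Finset.sum_insert (by simp [hne]), Finset.sum_insert (by simp [hne]),
      Finset.sum_singleton] at hz1
    have h0 := hz0 (vert 0 i)
    have h1 := hz0 (vert 1 i)
    have h2 := hz0 (vert 2 i)
    have hu0 : 0 ≤ z (vert 2 i) / 2 := by linarith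
    have hu1 : z (vert 2 i) / 2 ≤ 1 := by linarith
    refine ⟨z (vert 2 i) / 2, z (vert 1 i), hu0, hu1, h1, by linarith, by linarith, ?_⟩
    simp only [Finset.mem_insert, Finset.mem_singleton, forall_eq_or_imp, forall_eq,
      cylinderPoint_vert hv]
    rw [cylinderWeight_zero_self hm i hu0 hu1, cylinderWeight_one_self hm i hu0 hu1,
      cylinderWeight_two_self hm i hu0 hu1]
    grind
  · simp only [cylinderTriangle, Fin.mk_one, Matrix.cons_val_one, Matrix.cons_val_zero] at hz1 ⊢
    rw [Finset.sum_insert (by simp [hne, hi.symm]), Finset.sum_insert (by simp [hne]),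
      Finset.sum_singleton] at hz1
    have h0 := hz0 (vert 1 i)
    have h1 := hz0 (vert 2 i)
    have h2 := hz0 (vert 1 (i + 1))
    have hu0 : 0 ≤ z (vert 2 i) / 2 + z (vert 1 (i + 1)) := by linarith
    have hu1 : z (vert 2 i) / 2 + z (vert 1 (i + 1)) ≤ 1 := by linarith
    refine ⟨_, z (vert 1 i) + z (vert 1 (i + 1)), hu0, hu1, by linarith, by linarith,
      ⟨by linarith, by linarith⟩, ?_⟩
    simp only [Finset.mem_insert, Finset.mem_singleton, forall_eq_or_imp, forall_eq,
      cylinderPoint_vert hv]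
    rw [cylinderWeight_one_succ hm i hu0 hu1, cylinderWeight_one_self hm i hu0 hu1,
      cylinderWeight_two_self hm i hu0 hu1]
    grind
  · simp only [cylinderTriangle, Fin.reduceFinMk, Matrix.cons_val] at hz1 ⊢
    rw [Finset.sum_insert (by simp [hne]), Finset.sum_insert (by simp [hne]),
      Finset.sum_singleton] at hz1
    have h0 := hz0 (vert 0 (i + 1))
    have h1 := hz0 (vert 1 (i + 1))
    have h2 := hz0 (vert 2 i)
    have hu0 : 0 ≤ 1 - z (vert 2 i) / 2 := by linarith
    have hu1 : 1 - z (vert 2 i) / 2 ≤ 1 := by linarith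
    refine ⟨_, z (vert 1 (i + 1)), hu0, hu1, by linarith, by linarith, by linarith, ?_⟩
    simp only [Finset.mem_insert, Finset.mem_singleton, forall_eq_or_imp, forall_eq,
      cylinderPoint_vert hv]
    rw [cylinderWeight_one_succ hm i hu0 hu1, cylinderWeight_zero_succ hm i hu0 hu1,
      cylinderWeight_two_self hm i hu0 hu1]
    grind

-- The two weights add up to `1`, so the point lies on the segment above `circlePoint m i`. For `t <
-- 1` the first equation forces distance `0`, and for `t = 1` the second does.
omit [NeZero m] in
theorem eq_circlePoint_of_cylinderWeight_eq {s : AddCircle (m : ℝ)} {i : ZMod m} {t : ℝ}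
    (ht1 : t ≤ 1) (h0 : cylinderWeight 0 i s t = 1 - t) (h1 : cylinderWeight 1 i s t = t) :
    s = circlePoint m i := by
  simp only [cylinderWeight, Matrix.cons_val_zero, Matrix.cons_val_one] at h0 h1
  have hs := norm_nonneg (s - circlePoint m i)
  have : ‖s - circlePoint m i‖ = 0 := by
    generalize ‖s - circlePoint m i‖ = r at *
    rcases eq_or_lt_of_le ht1 with rfl | ht
    · grind
    · grind
  rwa [norm_eq_zero, sub_eq_zero] at this

theorem cylinderWeight_injective (hm : 3 ≤ m) {s s' : AddCircle (m : ℝ)} {t t' : ℝ} (ht0 : 0 ≤ t)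
    (ht1 : t ≤ 1) (ht0' : 0 ≤ t') (ht1' : t' ≤ 1)
    (h : ∀ κ (i : ZMod m), cylinderWeight κ i s t = cylinderWeight κ i s' t') :
    s = s' ∧ t = t' := by
  have htt : t = t' := by
    rw [← sum_cylinderWeight_one hm s ht0 ht1, ← sum_cylinderWeight_one hm s' ht0' ht1']
    exact Finset.sum_congr rfl fun i _ => h 1 i
  subst htt
  refine ⟨?_, rfl⟩
  obtain ⟨i, u, hu0, hu1, rfl⟩ := exists_circlePoint_add (by omega) s
  obtain ⟨i', u', hu0', hu1', rfl⟩ := exists_circlePoint_add (by omega) s'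
  have hx0 := cylinderWeight_zero_self hm i hu0 hu1 (t := t)
  have hx1 := cylinderWeight_zero_succ hm i hu0 hu1 (t := t)
  have hy0 := cylinderWeight_one_self hm i hu0 hu1 (t := t)
  have hy1 := cylinderWeight_one_succ hm i hu0 hu1 (t := t)
  have hc := cylinderWeight_two_self hm i hu0 hu1 (t := t)
  -- The ends of a sector belong to two sectors and are settled separately; for `0 < u < 1` the
  -- sector is determined.
  rcases eq_or_lt_of_le hu0 with hu | hu
  · have e : circlePoint m i + (u : AddCircle (m : ℝ)) = circlePoint m i := by simp [← hu]
    rw [e]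
    refine (eq_circlePoint_of_cylinderWeight_eq ht1 ?_ ?_).symm
    · rw [← h, hx0]; grind
    · rw [← h, hy0]; grind
  rcases eq_or_lt_of_le hu1 with hu' | hu'
  · have e : circlePoint m i + (u : AddCircle (m : ℝ)) = circlePoint m (i + 1) := by
      rw [hu', map_add, circlePoint_one]
    rw [e]
    refine (eq_circlePoint_of_cylinderWeight_eq ht1 ?_ ?_).symm
    · rw [← h, hx1]; grind
    · rw [← h, hy1]; grind
  -- The weight of `vert 2 i` is positive in the interior of sector `i` unless `t = 1`. On the top
  -- circle the weights of `vert 1 i` and `vert 1 (i + 1)` are both positive, and `m ≥ 3` makes this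
  -- pair of neighbours determine `i`.
  have hii : i = i' := by
    by_contra hne
    rw [h, cylinderWeight_two_of_ne hm i' hu0' hu1' hne] at hc
    have ht : t = 1 := by
      rcases abs_cases (u - 1 / 2) with h' | h' <;> grind
    subst ht
    have h1 : i = i' + 1 := by
      by_contra h1
      rw [h, cylinderWeight_one_of_ne hm i' hu0' hu1' le_rfl hne h1] at hy0
      grind
    have h2 : i + 1 = i' := by
      by_contra h2
      rw [h, cylinderWeight_one_of_ne hm i' hu0' hu1' le_rfl h2
        (fun h3 => hne (add_right_cancel h3))] at hy1
      grind
    exact zmod_add_one_add_one_ne hm i' (by rw [← h1, h2])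
  subst hii
  rw [h, cylinderWeight_zero_succ hm i hu0' hu1'] at hx1
  rw [h, cylinderWeight_one_succ hm i hu0' hu1'] at hy1
  rw [h, cylinderWeight_two_self hm i hu0' hu1'] at hc
  have huu : u = u' := by
    rcases abs_cases (u - 1 / 2) with h' | h' <;> rcases abs_cases (u' - 1 / 2) with h'' | h'' <;>
      rw [h'.1, h''.1] at hc <;> grind
  rw [huu]

/-- The complex with distinct vertices `vert κ i` triangulates the cylinder, with all vertices on the
boundary. -/
theorem triangulatesWithVerticesOn_cylinderComplex [Fintype V] (hm : 3 ≤ m)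
    (hv : Function.Injective2 vert) :
    TriangulatesWithVerticesOn (cylinderComplex vert) Cylinder cylinderBoundary := by
  have hm0 : (m : ℝ) ≠ 0 := by exact_mod_cast NeZero.ne m
  have : Fact (0 < (m : ℝ)) := ⟨by positivity⟩
  let F : AddCircle (m : ℝ) × unitInterval → realization (cylinderComplex vert) := fun p =>
    ⟨cylinderPoint vert p.1 p.2, cylinderPoint_mem_realization hm p.1 p.2.2.1 p.2.2.2⟩
  have hF : Continuous F := by
    refine Continuous.subtype_mk (continuous_pi fun v => ?_) _
    simp only [cylinderPoint]
    refine continuous_finsetSum _ fun p _ => ?_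
    split_ifs
    · exact (continuous_cylinderWeight p.1 p.2).comp
        (continuous_fst.prodMk (continuous_subtype_val.comp continuous_snd))
    · exact continuous_const
  have hbij : Function.Bijective F := by
    constructor
    · rintro ⟨s, t, ht⟩ ⟨s', t', ht'⟩ h
      have h' : cylinderPoint vert s t = cylinderPoint vert s' t' := congrArg Subtype.val h
      obtain ⟨rfl, rfl⟩ := cylinderWeight_injective hm ht.1 ht.2 ht'.1 ht'.2 fun κ i => by
        rw [← cylinderPoint_vert hv, ← cylinderPoint_vert hv, h']
      rfl
    · rintro ⟨z, hz⟩
      obtain ⟨s, t, ht0, ht1, rfl⟩ := eq_cylinderPoint_of_mem_realization hm hv hz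
      exact ⟨(s, ⟨t, ht0, ht1⟩), rfl⟩
  let G : AddCircle (m : ℝ) × unitInterval ≃ₜ realization (cylinderComplex vert) :=
    Continuous.homeoOfEquivCompactToT2 (f := Equiv.ofBijective F hbij) hF
  refine ⟨G.symm.trans ((AddCircle.homeomorphCircle hm0).prodCongr (Homeomorph.refl _)), ?_⟩
  intro x v hx
  obtain ⟨⟨s, t⟩, rfl⟩ := G.surjective x
  have hx' : cylinderPoint vert s t v = 1 := hx
  change (G.symm (G (s, t))).2 = 0 ∨ (G.symm (G (s, t))).2 = 1
  rw [G.symm_apply_apply]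
  have hex : ∃ κ i, vert κ i = v := by
    by_contra! hne
    rw [cylinderPoint_eq_zero fun κ i h => absurd h (hne κ i)] at hx'
    exact zero_ne_one hx'
  obtain ⟨κ, i, rfl⟩ := hex
  rw [cylinderPoint_vert hv] at hx'
  have ht0 := t.2.1
  have ht1 := t.2.2
  have hs := norm_nonneg (s - circlePoint m i)
  suffices (t : ℝ) = 0 ∨ (t : ℝ) = 1 by
    rcases this with h | h
    · exact Or.inl (Subtype.ext h)
    · exact Or.inr (Subtype.ext h)
  fin_cases κ <;> simp [cylinderWeight] at hx' <;> grind

omit [NeZero m] in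
theorem card_cylinderTriangle (hm : 3 ≤ m) (hv : Function.Injective2 vert) (κ : Fin 3)
    (i : ZMod m) : (cylinderTriangle vert κ i).card = 3 := by
  have hi := zmod_add_one_ne hm i
  fin_cases κ <;> exact Finset.card_eq_three.2 ⟨_, _, _, by simp [hv.eq_iff, hi.symm],
    by simp [hv.eq_iff, hi.symm], by simp [hv.eq_iff, hi.symm], rfl⟩

/-- Each triangle contains exactly one vertex `vert 2 i`, which reveals its sector. Within the
sector, the three triangles differ in which of `vert 0 i` and `vert 0 (i + 1)` they contain. -/
theorem card_cylinderComplex (hm : 3 ≤ m) (hv : Function.Injective2 vert) :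
    (cylinderComplex vert).card = 3 * m := by
  have hmem : ∀ κ i j, vert 2 j ∈ cylinderTriangle vert κ i ↔ j = i := by
    intro κ i j
    fin_cases κ <;> simp [cylinderTriangle, hv.eq_iff]
  have hmem0 : ∀ κ i j, vert 0 j ∈ cylinderTriangle vert κ i ↔
      (κ = 0 ∧ j = i ∨ κ = 2 ∧ j = i + 1) := by
    intro κ i j
    fin_cases κ <;> simp [cylinderTriangle, hv.eq_iff]
  rw [cylinderComplex, Finset.card_image_of_injective]
  · simp [ZMod.card]
  · rintro ⟨κ, i⟩ ⟨κ', i'⟩ h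
    dsimp only at h
    obtain rfl : i = i' := by rw [← hmem κ', ← h, hmem]
    have h0 := hmem0 κ i i
    have h2 := hmem0 κ i (i + 1)
    rw [h, hmem0] at h0 h2
    have hi := zmod_add_one_ne hm i
    simp only [hi, hi.symm, and_true, and_false, or_false, false_or] at h0 h2
    congr 1
    clear h hmem hmem0
    revert h0 h2
    revert κ κ'
    decide

theorem isTorusLike_cylinderComplex [Fintype V] (hm : 3 ≤ m) (hme : Even m)
    (hv : Function.Injective2 vert) : IsTorusLike (cylinderComplex vert) := by
  have h : IsCylinderCycle (cylinderComplex vert) := by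
    refine ⟨?_, triangulatesWithVerticesOn_cylinderComplex hm hv⟩
    intro e he
    obtain ⟨p, -, rfl⟩ := Finset.mem_image.1 (Finset.mem_coe.1 he)
    exact card_cylinderTriangle hm hv _ _
  refine ⟨Or.inl h, Or.inl ⟨?_, h⟩⟩
  rw [card_cylinderComplex hm hv]
  exact hme.mul_left 3

end Realization

end CylinderTriangulation

/-! ### Traces of matrix products as sums over closed walks. -/

section ClosedWalks

open Matrix

variable {σ : Type*} [Fintype σ] [DecidableEq σ]

/-- The trace of a product of matrices as a sum over closed walks. -/
theorem trace_prod_ofFn_mul {n : ℕ} (A : Fin n → Matrix σ σ ℝ) (B : Matrix σ σ ℝ) :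
    ((List.ofFn A).prod * B).trace =
      ∑ f : Fin (n + 1) → σ,
        (∏ i : Fin n, A i (f i.castSucc) (f i.succ)) * B (f (Fin.last n)) (f 0) := by
  induction n generalizing B with
  | zero =>
    rw [← (Equiv.funUnique (Fin 1) σ).symm.sum_comp]
    simp [Matrix.trace]
  | succ n ih =>
    -- Cyclicity of the trace moves the first factor behind `B`, and the induction hypothesis is
    -- applied with this product as the closing matrix.
    rw [List.ofFn_succ, List.prod_cons, Matrix.mul_assoc, Matrix.trace_mul_comm, Matrix.mul_assoc,
      ih, ← (Fin.consEquiv fun _ : Fin (n + 2) => σ).sum_comp, Fintype.sum_prod_type,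
      Finset.sum_comm]
    refine Finset.sum_congr rfl fun g _ => ?_
    rw [Matrix.mul_apply, Finset.mul_sum]
    refine Finset.sum_congr rfl fun s _ => ?_
    rw [Fin.prod_univ_succ]
    simp only [Fin.consEquiv_apply, Fin.castSucc_zero, Fin.cons_zero, Fin.cons_succ,
      ← Fin.succ_castSucc, ← Fin.succ_last]
    ring

theorem trace_prod_range (n : ℕ) (A : ℕ → Matrix σ σ ℝ) :
    (((List.range (n + 1)).map A).prod).trace =
      ∑ f : Fin (n + 1) → σ, ∏ i : Fin (n + 1), A i (f i) (f (i + 1)) := by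
  have h : (List.range n).map A = List.ofFn fun i : Fin n => A i := by
    rw [List.ofFn_eq_map, ← List.map_coe_finRange_eq_range, List.map_map]
    rfl
  rw [List.range_succ, List.map_append, List.prod_append, List.map_singleton, List.prod_singleton,
    h, trace_prod_ofFn_mul]
  refine Finset.sum_congr rfl fun f _ => ?_
  rw [Fin.prod_univ_castSucc]
  simp

theorem map_range_prod_const {M : Matrix σ σ ℝ} {A : ℕ → Matrix σ σ ℝ} (n : ℕ)
    (h : ∀ i < n, A i = M) : ((List.range n).map A).prod = M ^ n := by
  rw [List.map_congr_left (g := fun _ => M) fun i hi => h i (List.mem_range.1 hi)]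
  simp

/-- Closed walks of length `a + b + 2` with two marked steps. -/
theorem trace_mul_pow_mul_mul_pow (X Y M : Matrix σ σ ℝ) (a b : ℕ) :
    (X * M ^ a * Y * M ^ b).trace =
      ∑ f : Fin (a + b + 1 + 1) → σ, ∏ i : Fin (a + b + 1 + 1),
        (if (i : ℕ) = 0 then X else if (i : ℕ) = a + 1 then Y else M) (f i) (f (i + 1)) := by
  rw [← trace_prod_range (a + b + 1)
    fun i => if i = 0 then X else if i = a + 1 then Y else M]
  congr 1
  rw [show a + b + 1 + 1 = (1 + a) + (1 + b) by ring, List.range_add, List.range_add,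
    List.range_add (n := 1) (m := b)]
  simp only [List.map_append, List.map_map, List.prod_append]
  rw [map_range_prod_const (M := M) a, map_range_prod_const (M := M) b]
  · simp [Matrix.mul_assoc, add_comm 1 a]
  · intro i hi
    simp only [Function.comp_apply]
    rw [if_neg (by omega), if_neg (by omega)]
  · intro i hi
    simp only [Function.comp_apply]
    rw [if_neg (by omega), if_neg (by omega)]

theorem trace_pow_eq_sum (n : ℕ) (M : Matrix σ σ ℝ) :
    (M ^ (n + 1)).trace = ∑ f : Fin (n + 1) → σ, ∏ i : Fin (n + 1), M (f i) (f (i + 1)) := by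
  rw [← map_range_prod_const (A := fun _ => M) (n + 1) fun _ _ => rfl, trace_prod_range]

end ClosedWalks

/-! ### The Cauchy–Schwarz bound for one conflict. -/

section Conflicts

open Matrix

variable {σ ι : Type*} [Fintype σ] [DecidableEq σ] [Fintype ι]

omit [DecidableEq σ] in
theorem matrix_mul_nonneg {A B : Matrix σ σ ℝ} (hA : ∀ s t, 0 ≤ A s t) (hB : ∀ s t, 0 ≤ B s t)
    (s t : σ) : 0 ≤ (A * B) s t := by
  rw [Matrix.mul_apply]
  exact Finset.sum_nonneg fun r _ => mul_nonneg (hA _ _) (hB _ _)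

theorem matrix_pow_nonneg {A : Matrix σ σ ℝ} (hA : ∀ s t, 0 ≤ A s t) (n : ℕ) (s t : σ) :
    0 ≤ (A ^ n) s t := by
  induction n generalizing s t with
  | zero => rw [pow_zero, Matrix.one_apply]; split_ifs <;> norm_num
  | succ n ih => rw [pow_succ]; exact matrix_mul_nonneg ih hA s t

theorem trace_pow_two_mul {M : Matrix σ σ ℝ} (hM : M.IsSymm) (j : ℕ) :
    (M ^ (2 * j)).trace = ∑ s, ∑ t, (M ^ j) s t ^ 2 := by
  have h : (M ^ j).IsSymm := hM.pow j
  rw [two_mul, pow_add, Matrix.trace]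
  refine Finset.sum_congr rfl fun s _ => ?_
  rw [Matrix.diag_apply, Matrix.mul_apply]
  refine Finset.sum_congr rfl fun t _ => ?_
  rw [h.apply s t, sq]

/-- The weight of the closed walks of length `2 j` in which the labels of two given steps agree,
bounded by the weights of all closed walks of lengths `2 j` and `2 j - 2`. -/
theorem sum_trace_conflict_sq_le {M : Matrix σ σ ℝ} (hM : M.IsSymm) {X Y : ι → Matrix σ σ ℝ}
    (hX0 : ∀ q s t, 0 ≤ X q s t) (hY0 : ∀ q s t, 0 ≤ Y q s t) (hX : ∑ q, X q = M)
    (hY : ∑ q, Y q = M) {g : σ → ℝ} (hg : ∀ s, 0 < g s) {η : ℝ}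
    (hη : ∀ q t, ∑ s, X q s t * g s ≤ η * g t) (hMg : ∀ s, ∑ t, M s t * g t ≤ g s) (a b : ℕ) :
    (∑ q, (X q * M ^ a * Y q * M ^ (b + (a + b))).trace) ^ 2 ≤
      η * (M ^ (2 * (a + b + 1))).trace * (M ^ (2 * (a + b))).trace := by
  have hM0 : ∀ s t, 0 ≤ M s t := fun s t => by
    rw [← hX, Matrix.sum_apply]
    exact Finset.sum_nonneg fun q _ => hX0 q s t
  -- With `j = a + b + 1`, a closed walk of length `2 j` is cut into the first marked step `X q`, a
  -- piece `W q` of length `j` containing the second marked step, and a piece `B` of length `j - 1`.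
  set W : ι → Matrix σ σ ℝ := fun q => M ^ a * Y q * M ^ b with hW
  have hW0 : ∀ q s t, 0 ≤ W q s t := fun q =>
    matrix_mul_nonneg (matrix_mul_nonneg (matrix_pow_nonneg hM0 a) (hY0 q))
      (matrix_pow_nonneg hM0 b)
  have hWs : ∑ q, W q = M ^ (a + b + 1) := by
    simp only [hW]
    rw [← Finset.sum_mul, ← Finset.mul_sum, hY, ← pow_succ, ← pow_add]
    congr 1
    ring
  set B : Matrix σ σ ℝ := M ^ (a + b)
  have hB0 : ∀ s t, 0 ≤ B s t := matrix_pow_nonneg hM0 _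
  have hBs : B.IsSymm := hM.pow _
  -- The inserted ratios of `g` cancel in the product. In the factor with `W` they allow summation
  -- over `s` by `hη`, in the factor with `B` summation over `q` and `r` by `hMg`.
  have hexp : ∑ q, (X q * M ^ a * Y q * M ^ (b + (a + b))).trace =
      ∑ p : (ι × σ) × (σ × σ),
        √(X p.1.1 p.1.2 p.2.1 * (g p.1.2 / g p.2.1) * W p.1.1 p.2.1 p.2.2 ^ 2) *
        √(X p.1.1 p.1.2 p.2.1 * (g p.2.1 / g p.1.2) * B p.1.2 p.2.2 ^ 2) := by
    simp only [Fintype.sum_prod_type]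
    refine Finset.sum_congr rfl fun q _ => ?_
    have : X q * M ^ a * Y q * M ^ (b + (a + b)) = X q * (W q * B) := by
      simp only [hW, B, pow_add, Matrix.mul_assoc]
    rw [this, Matrix.trace]
    refine Finset.sum_congr rfl fun s _ => ?_
    rw [Matrix.diag_apply, Matrix.mul_apply]
    refine Finset.sum_congr rfl fun r _ => ?_
    rw [Matrix.mul_apply, Finset.mul_sum]
    refine Finset.sum_congr rfl fun t _ => ?_
    have hs := hg s
    have hr := hg r
    have h1 := hX0 q s r
    have h2 := hW0 q r t
    have h3 := hB0 s t
    rw [← Real.sqrt_mul (by positivity), hBs.apply]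
    rw [show X q s r * (g s / g r) * W q r t ^ 2 * (X q s r * (g r / g s) * B s t ^ 2) =
      (X q s r * (W q r t * B s t)) ^ 2 by field_simp, Real.sqrt_sq (by positivity)]
  have hnn : ∀ q s r (x : ℝ), 0 ≤ X q s r * (g s / g r) * x ^ 2 := fun q s r x => by
    have hs := hg s
    have hr := hg r
    have h1 := hX0 q s r
    positivity
  have hnn' : ∀ q s r (x : ℝ), 0 ≤ X q s r * (g r / g s) * x ^ 2 := fun q s r x => by
    have hs := hg s
    have hr := hg r
    have h1 := hX0 q s r
    positivity
  have hfirst : ∑ p : (ι × σ) × (σ × σ),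
      X p.1.1 p.1.2 p.2.1 * (g p.1.2 / g p.2.1) * W p.1.1 p.2.1 p.2.2 ^ 2 ≤
        η * (M ^ (2 * (a + b + 1))).trace := by
    rw [trace_pow_two_mul hM]
    simp only [Fintype.sum_prod_type]
    have h1 : ∀ q, ∑ s, ∑ r, ∑ t, X q s r * (g s / g r) * W q r t ^ 2 ≤
        η * ∑ r, ∑ t, W q r t ^ 2 := by
      intro q
      rw [Finset.sum_comm, Finset.mul_sum]
      refine Finset.sum_le_sum fun r _ => ?_
      rw [Finset.sum_comm, Finset.mul_sum]
      refine Finset.sum_le_sum fun t _ => ?_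
      rw [← Finset.sum_mul]
      refine mul_le_mul_of_nonneg_right ?_ (sq_nonneg _)
      have := hη q r
      rw [← div_le_iff₀ (hg r), Finset.sum_div] at this
      simpa only [mul_div_assoc] using this
    -- Because the `W q` are nonnegative, the sum of their squares is at most the square of their
    -- sum. Summing over the common label therefore costs nothing and the gain `η` survives.
    have hη0 : (∑ q, ∑ r, ∑ t, η * W q r t ^ 2) ≤ ∑ r, ∑ t, η * (M ^ (a + b + 1)) r t ^ 2 := by
      rw [Finset.sum_comm]
      refine Finset.sum_le_sum fun r _ => ?_
      rw [Finset.sum_comm]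
      refine Finset.sum_le_sum fun t _ => ?_
      rw [← Finset.mul_sum]
      rcases isEmpty_or_nonempty ι with hι | ⟨⟨q₀⟩⟩
      · have : M ^ (a + b + 1) = 0 := by rw [← hWs]; simp
        simp [this]
      have hη0 : 0 ≤ η := by
        have h := (Finset.sum_nonneg fun s _ => mul_nonneg (hX0 q₀ s r) (hg s).le).trans (hη q₀ r)
        exact nonneg_of_mul_nonneg_left h (hg r)
      refine mul_le_mul_of_nonneg_left ?_ hη0
      rw [← hWs, Matrix.sum_apply, sq, Finset.sum_mul]
      refine Finset.sum_le_sum fun q _ => ?_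
      rw [sq]
      exact mul_le_mul_of_nonneg_left
        (Finset.single_le_sum (f := fun q => W q r t) (fun q _ => hW0 q r t) (Finset.mem_univ q))
        (hW0 q r t)
    refine (Finset.sum_le_sum fun q _ => h1 q).trans ?_
    simpa only [Finset.mul_sum] using hη0
  have hsecond : ∑ p : (ι × σ) × (σ × σ),
      X p.1.1 p.1.2 p.2.1 * (g p.2.1 / g p.1.2) * B p.1.2 p.2.2 ^ 2 ≤
        (M ^ (2 * (a + b))).trace := by
    rw [trace_pow_two_mul hM]
    simp only [Fintype.sum_prod_type]
    rw [Finset.sum_comm]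
    refine Finset.sum_le_sum fun s _ => ?_
    have h : ∀ q, ∑ r, ∑ t, X q s r * (g r / g s) * B s t ^ 2 =
        (∑ r, X q s r * (g r / g s)) * ∑ t, B s t ^ 2 := fun q => by
      rw [Finset.sum_mul_sum]
    rw [Finset.sum_congr rfl fun q _ => h q, ← Finset.sum_mul]
    refine mul_le_of_le_one_left (Finset.sum_nonneg fun t _ => sq_nonneg _) ?_
    rw [Finset.sum_comm]
    have h2 : ∀ r, ∑ q, X q s r * (g r / g s) = M s r * g r / g s := fun r => by
      rw [← Finset.sum_mul, ← hX, Matrix.sum_apply, mul_div_assoc]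
    rw [Finset.sum_congr rfl fun r _ => h2 r, ← Finset.sum_div, div_le_one (hg s)]
    exact hMg s
  rw [hexp]
  have hcs := Real.sum_sqrt_mul_sqrt_le Finset.univ
    (f := fun p : (ι × σ) × (σ × σ) =>
      X p.1.1 p.1.2 p.2.1 * (g p.1.2 / g p.2.1) * W p.1.1 p.2.1 p.2.2 ^ 2)
    (g := fun p : (ι × σ) × (σ × σ) =>
      X p.1.1 p.1.2 p.2.1 * (g p.2.1 / g p.1.2) * B p.1.2 p.2.2 ^ 2)
    (fun p => hnn _ _ _ _) (fun p => hnn' _ _ _ _)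
  refine (pow_le_pow_left₀ (Finset.sum_nonneg fun p _ => by positivity) hcs 2).trans ?_
  have hA0 := Finset.sum_nonneg fun (p : (ι × σ) × (σ × σ)) (_ : p ∈ Finset.univ) =>
    hnn p.1.1 p.1.2 p.2.1 (W p.1.1 p.2.1 p.2.2)
  have hC0 := Finset.sum_nonneg fun (p : (ι × σ) × (σ × σ)) (_ : p ∈ Finset.univ) =>
    hnn' p.1.1 p.1.2 p.2.1 (B p.1.2 p.2.2)
  rw [mul_pow, Real.sq_sqrt hA0, Real.sq_sqrt hC0]
  exact mul_le_mul hfirst hsecond hC0 (hA0.trans hfirst)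

end Conflicts

/-! ### From conflicts in all closed walks to a bound on traces. -/

section LabelledWalks

open Matrix

variable {σ V : Type*} [Fintype σ] [Fintype V]

/-- The matrix of the steps with weights `S`, irrespective of the colour of the step. -/
def stepMatrix (S : σ → V → σ → ℝ) : Matrix σ σ ℝ :=
  Matrix.of fun s t => ∑ c, S s c t

/-- The matrix of the steps with weights `S` and label `q`, where the label of a step is a function
`lab` of its starting point and colour. -/
def labelledStepMatrix [DecidableEq V] (S : σ → V → σ → ℝ) (lab : σ → V → V) (q : V) :
    Matrix σ σ ℝ :=
  Matrix.of fun s t => ∑ c, if lab s c = q then S s c t else 0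

omit [Fintype σ] in
theorem sum_labelledStepMatrix [DecidableEq V] (S : σ → V → σ → ℝ) (lab : σ → V → V) :
    ∑ q, labelledStepMatrix S lab q = stepMatrix S := by
  ext s t
  simp only [Matrix.sum_apply, labelledStepMatrix, stepMatrix, Matrix.of_apply]
  rw [Finset.sum_comm]
  simp

/-- The weight of the closed walk with states `f` and colours `c`. -/
def walkWeight {n : ℕ} (S : σ → V → σ → ℝ) (f : Fin (n + 1) → σ) (c : Fin (n + 1) → V) : ℝ :=
  ∏ i, S (f i) (c i) (f (i + 1))

omit [Fintype σ] [Fintype V] in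
theorem walkWeight_nonneg {n : ℕ} {S : σ → V → σ → ℝ} (hS : ∀ s c t, 0 ≤ S s c t)
    (f : Fin (n + 1) → σ) (c : Fin (n + 1) → V) : 0 ≤ walkWeight S f c :=
  Finset.prod_nonneg fun _ _ => hS _ _ _

omit [Fintype σ] [Fintype V] in
theorem walkWeight_rotate {n : ℕ} (S : σ → V → σ → ℝ) (f : Fin (n + 1) → σ)
    (c : Fin (n + 1) → V) (p : Fin (n + 1)) :
    walkWeight S (fun i => f (i + p)) (fun i => c (i + p)) = walkWeight S f c := by
  refine Fintype.prod_equiv (Equiv.addRight p) _ _ fun i => ?_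
  rw [Equiv.coe_addRight, add_right_comm]

variable [DecidableEq σ]

theorem trace_stepMatrix_pow (S : σ → V → σ → ℝ) (n : ℕ) :
    (stepMatrix S ^ (n + 1)).trace =
      ∑ f : Fin (n + 1) → σ, ∑ c : Fin (n + 1) → V, walkWeight S f c := by
  rw [trace_pow_eq_sum]
  refine Finset.sum_congr rfl fun f _ => ?_
  simp only [stepMatrix, Matrix.of_apply]
  rw [Finset.prod_univ_sum, Fintype.piFinset_univ]
  rfl

theorem prod_ite_ite_eq_mul {n : ℕ} {d : Fin (n + 1)} (hd : d ≠ 0) (u : Fin (n + 1) → ℝ) :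
    ∏ i, (if i = 0 then u i else if i = d then u i else 1) = u 0 * u d := by
  rw [Fintype.prod_eq_mul 0 d hd.symm]
  · simp [hd]
  · rintro i ⟨h1, h2⟩
    simp [h1, h2]

/-- The weight of the closed walks in which a label of the starting step agrees with a label of a
later step. -/
theorem sum_trace_labelledStepMatrix [DecidableEq V] (S : σ → V → σ → ℝ) (lab lab' : σ → V → V)
    (a b : ℕ) {d : Fin (a + b + 1 + 1)} (hd : (d : ℕ) = a + 1) :
    ∑ q, (labelledStepMatrix S lab q * stepMatrix S ^ a * labelledStepMatrix S lab' q *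
      stepMatrix S ^ b).trace =
      ∑ f : Fin (a + b + 1 + 1) → σ, ∑ c : Fin (a + b + 1 + 1) → V,
        if lab (f 0) (c 0) = lab' (f d) (c d) then walkWeight S f c else 0 := by
  have hd0 : d ≠ 0 := by
    rintro rfl
    simp at hd
  simp only [trace_mul_pow_mul_mul_pow]
  rw [Finset.sum_comm]
  refine Finset.sum_congr rfl fun f _ => ?_
  have h : ∀ q, ∏ i : Fin (a + b + 1 + 1), (if (i : ℕ) = 0 then labelledStepMatrix S lab q
      else if (i : ℕ) = a + 1 then labelledStepMatrix S lab' q else stepMatrix S) (f i) (f (i + 1))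
      = ∑ c : Fin (a + b + 1 + 1) → V,
        (if lab (f 0) (c 0) = q then 1 else 0) * (if lab' (f d) (c d) = q then 1 else 0) *
          walkWeight S f c := by
    intro q
    let w : Fin (a + b + 1 + 1) → V → ℝ := fun i c =>
      if i = 0 then (if lab (f i) c = q then 1 else 0)
      else if i = d then (if lab' (f i) c = q then 1 else 0) else 1
    have h1 : ∀ i : Fin (a + b + 1 + 1), (if (i : ℕ) = 0 then labelledStepMatrix S lab q
        else if (i : ℕ) = a + 1 then labelledStepMatrix S lab' q else stepMatrix S)
          (f i) (f (i + 1)) = ∑ c, w i c * S (f i) c (f (i + 1)) := by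
      intro i
      have e1 : (i : ℕ) = 0 ↔ i = 0 := by rw [Fin.ext_iff]; rfl
      have e2 : (i : ℕ) = a + 1 ↔ i = d := by rw [Fin.ext_iff, hd]
      simp only [e1, e2, w]
      split_ifs <;> simp [labelledStepMatrix, stepMatrix]
    rw [Finset.prod_congr rfl fun i _ => h1 i, Finset.prod_univ_sum, Fintype.piFinset_univ]
    refine Finset.sum_congr rfl fun c _ => ?_
    rw [Finset.prod_mul_distrib]
    congr 1
    have h2 := prod_ite_ite_eq_mul hd0 fun i =>
      if i = 0 then (if lab (f i) (c i) = q then (1 : ℝ) else 0)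
      else (if lab' (f i) (c i) = q then 1 else 0)
    simp only [if_neg hd0, if_true] at h2
    rw [← h2]
    refine Finset.prod_congr rfl fun i _ => ?_
    simp only [w]
    split_ifs <;> rfl
  rw [Finset.sum_congr rfl fun q _ => h q, Finset.sum_comm]
  refine Finset.sum_congr rfl fun c _ => ?_
  rw [← Finset.sum_mul]
  simp [eq_comm]

variable [DecidableEq V] {S : σ → V → σ → ℝ} {g : σ → ℝ} {η : ℝ}

theorem sum_conflict_sq_le (hS : ∀ s c t, 0 ≤ S s c t) (hM : (stepMatrix S).IsSymm)
    (hg : ∀ s, 0 < g s) {lab lab' : σ → V → V}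
    (hη : ∀ q t, ∑ s, labelledStepMatrix S lab q s t * g s ≤ η * g t)
    (hMg : ∀ s, ∑ t, stepMatrix S s t * g t ≤ g s) {n j : ℕ} (hn : n + 1 = 2 * j)
    {d : Fin (n + 1)} (hd0 : d ≠ 0) (hd : (d : ℕ) ≤ j) (p : Fin (n + 1)) :
    (∑ f : Fin (n + 1) → σ, ∑ c : Fin (n + 1) → V,
      if lab (f p) (c p) = lab' (f (p + d)) (c (p + d)) then walkWeight S f c else 0) ^ 2 ≤
      η * (stepMatrix S ^ (2 * j)).trace * (stepMatrix S ^ (2 * (j - 1))).trace := by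
  have hrot : (∑ f : Fin (n + 1) → σ, ∑ c : Fin (n + 1) → V,
      if lab (f p) (c p) = lab' (f (p + d)) (c (p + d)) then walkWeight S f c else 0) =
      ∑ f : Fin (n + 1) → σ, ∑ c : Fin (n + 1) → V,
      if lab (f 0) (c 0) = lab' (f d) (c d) then walkWeight S f c else 0 := by
    refine Fintype.sum_equiv ((Equiv.addRight p).symm.arrowCongr (Equiv.refl σ)) _ _ fun f => ?_
    refine Fintype.sum_equiv ((Equiv.addRight p).symm.arrowCongr (Equiv.refl V)) _ _ fun c => ?_
    have hf : (Equiv.addRight p).symm.arrowCongr (Equiv.refl σ) f = fun i => f (i + p) := rfl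
    have hc : (Equiv.addRight p).symm.arrowCongr (Equiv.refl V) c = fun i => c (i + p) := rfl
    rw [hf, hc, walkWeight_rotate]
    simp only [zero_add, add_comm d p]
  rw [hrot]
  have hdv : (d : ℕ) ≠ 0 := fun h => hd0 (Fin.ext h)
  obtain ⟨a, ha⟩ : ∃ a, (d : ℕ) = a + 1 := ⟨d - 1, by omega⟩
  -- The hypothesis `d ≤ j` places the second marked step among the `j` steps that follow the first,
  -- as the cut of the walk requires.
  obtain ⟨b, rfl⟩ : ∃ b, j = a + b + 1 := ⟨j - d, by omega⟩
  obtain rfl : n = a + (b + (a + b)) + 1 := by omega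
  rw [← sum_trace_labelledStepMatrix S lab lab' a (b + (a + b)) ha]
  have hnn : ∀ (l : σ → V → V) q s t, 0 ≤ labelledStepMatrix S l q s t := fun l q s t => by
    simp only [labelledStepMatrix, Matrix.of_apply]
    exact Finset.sum_nonneg fun c _ => by
      split_ifs
      · exact hS _ _ _
      · exact le_rfl
  exact sum_trace_conflict_sq_le hM (hnn lab) (hnn lab') (sum_labelledStepMatrix S lab)
    (sum_labelledStepMatrix S lab') hg hη hMg a b

/-- If the labels of every closed walk of length `2 j` collide, then there are few such walks. -/
theorem trace_pow_le_of_forall_conflict {κ : Type*} [Fintype κ] (hS : ∀ s c t, 0 ≤ S s c t)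
    (hM : (stepMatrix S).IsSymm) (hg : ∀ s, 0 < g s) {lab : κ → σ → V → V}
    (hη : ∀ α q t, ∑ s, labelledStepMatrix S (lab α) q s t * g s ≤ η * g t) (hη0 : 0 ≤ η)
    (hMg : ∀ s, ∑ t, stepMatrix S s t * g t ≤ g s) {n j : ℕ} (hn : n + 1 = 2 * j)
    (hconf : ∀ (f : Fin (n + 1) → σ) (c : Fin (n + 1) → V), walkWeight S f c ≠ 0 →
      ∃ i l, i ≠ l ∧ ∃ α β, lab α (f i) (c i) = lab β (f l) (c l)) :
    (stepMatrix S ^ (2 * j)).trace ≤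
      (4 * j ^ 2 * Fintype.card κ ^ 2) ^ 2 * η * (stepMatrix S ^ (2 * (j - 1))).trace := by
  set t := (stepMatrix S ^ (2 * j)).trace with ht
  set t' := (stepMatrix S ^ (2 * (j - 1))).trace with ht'
  have ht'0 : 0 ≤ t' := by
    rw [ht', trace_pow_two_mul hM]
    exact Finset.sum_nonneg fun _ _ => Finset.sum_nonneg fun _ _ => sq_nonneg _
  have ht0 : 0 ≤ t := by
    rw [ht, trace_pow_two_mul hM]
    exact Finset.sum_nonneg fun _ _ => Finset.sum_nonneg fun _ _ => sq_nonneg _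
  have hbound : t ≤ ∑ x : (Fin (n + 1) × Fin (n + 1)) × (κ × κ), √(η * t * t') := by
    have h1 : t = ∑ f : Fin (n + 1) → σ, ∑ c : Fin (n + 1) → V, walkWeight S f c := by
      rw [ht, ← hn, trace_stepMatrix_pow]
    have h2 : ∀ (f : Fin (n + 1) → σ) (c : Fin (n + 1) → V), walkWeight S f c ≤
        ∑ x : (Fin (n + 1) × Fin (n + 1)) × (κ × κ), if x.1.2 ≠ 0 ∧ (x.1.2 : ℕ) ≤ j then
          (if lab x.2.1 (f x.1.1) (c x.1.1) = lab x.2.2 (f (x.1.1 + x.1.2)) (c (x.1.1 + x.1.2))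
            then walkWeight S f c else 0) else 0 := by
      intro f c
      have hw := walkWeight_nonneg hS f c
      have hnn : ∀ x ∈ (Finset.univ : Finset ((Fin (n + 1) × Fin (n + 1)) × (κ × κ))),
          0 ≤ (if x.1.2 ≠ 0 ∧ (x.1.2 : ℕ) ≤ j then
          (if lab x.2.1 (f x.1.1) (c x.1.1) = lab x.2.2 (f (x.1.1 + x.1.2)) (c (x.1.1 + x.1.2))
            then walkWeight S f c else 0) else 0) := by
        intro x _
        split_ifs <;> first | exact hw | exact le_rfl
      by_cases h0 : walkWeight S f c = 0
      · rw [h0] at hnn ⊢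
        exact Finset.sum_nonneg hnn
      have key : ∃ x : (Fin (n + 1) × Fin (n + 1)) × (κ × κ), (x.1.2 ≠ 0 ∧ (x.1.2 : ℕ) ≤ j) ∧
          lab x.2.1 (f x.1.1) (c x.1.1) = lab x.2.2 (f (x.1.1 + x.1.2)) (c (x.1.1 + x.1.2)) := by
        obtain ⟨i, l, hil, α, β, h⟩ := hconf f c h0
        -- The two cyclic distances between the conflicting steps add up to `2 j`, so one of them is
        -- at most `j`; the walk is read from the corresponding step.
        rcases le_total ((l - i : Fin (n + 1)) : ℕ) j with hj | hj
        · exact ⟨((i, l - i), (α, β)), ⟨sub_ne_zero.2 hil.symm, hj⟩, by simpa using h⟩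
        · refine ⟨((l, i - l), (β, α)), ⟨sub_ne_zero.2 hil, ?_⟩, by simpa using h.symm⟩
          have hne : l - i ≠ 0 := sub_ne_zero.2 hil.symm
          have : ((i - l : Fin (n + 1)) : ℕ) = n + 1 - ((l - i : Fin (n + 1)) : ℕ) := by
            rw [← neg_sub l i, Fin.val_neg, if_neg hne]
          dsimp only
          omega
      obtain ⟨x, hx1, hx2⟩ := key
      refine le_trans ?_ (Finset.single_le_sum hnn (Finset.mem_univ x))
      rw [if_pos hx1, if_pos hx2]
    refine h1.le.trans ?_
    refine (Finset.sum_le_sum fun f _ => Finset.sum_le_sum fun c _ => h2 f c).trans ?_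
    rw [Finset.sum_congr rfl fun f _ => Finset.sum_comm, Finset.sum_comm]
    refine Finset.sum_le_sum fun x _ => ?_
    by_cases hx : x.1.2 ≠ 0 ∧ (x.1.2 : ℕ) ≤ j
    · simp only [if_pos hx]
      have h3 := sum_conflict_sq_le hS hM hg (lab' := lab x.2.2) (hη x.2.1) hMg hn hx.1 hx.2 x.1.1
      exact Real.le_sqrt_of_sq_le h3
    · simp only [if_neg hx, Finset.sum_const_zero]
      exact Real.sqrt_nonneg _
  -- The constant counts `2 j` starting positions, `2 j` offsets and the pairs of label functions.
  rw [Finset.sum_const, Finset.card_univ, nsmul_eq_mul] at hbound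
  simp only [Fintype.card_prod, Fintype.card_fin] at hbound
  rw [hn] at hbound
  have hsq := pow_le_pow_left₀ ht0 hbound 2
  rw [mul_pow, Real.sq_sqrt (by positivity)] at hsq
  push_cast at hsq
  -- The bound obtained is on `t ^ 2` and contains a factor `t`, which is cancelled unless `t = 0`.
  rcases eq_or_lt_of_le ht0 with h | h
  · rw [← h]; positivity
  refine le_of_mul_le_mul_right ?_ h
  calc t * t = t ^ 2 := (sq t).symm
    _ ≤ _ := hsq
    _ = _ := by ring

/-- As `M ^ k` fixes `w`, its quadratic form at `w` is `|w|²`; by Cauchy–Schwarz the square of this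
is at most the sum of the squared entries of `M ^ k` times `|w|⁴`. -/
theorem one_le_trace_pow_two_mul {M : Matrix σ σ ℝ} (hM : M.IsSymm) {w : σ → ℝ} (hw : w ≠ 0)
    (hMw : M *ᵥ w = w) (k : ℕ) : 1 ≤ (M ^ (2 * k)).trace := by
  have hk : (M ^ k) *ᵥ w = w := by
    induction k with
    | zero => simp
    | succ k ih => rw [pow_succ, ← Matrix.mulVec_mulVec, hMw, ih]
  have hpos : 0 < ∑ s, w s ^ 2 := by
    obtain ⟨s, hs⟩ := Function.ne_iff.1 hw
    exact Finset.sum_pos' (fun _ _ => sq_nonneg _) ⟨s, Finset.mem_univ s, by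
      have : w s ≠ 0 := hs
      positivity⟩
  rw [trace_pow_two_mul hM]
  have hcs := Finset.sum_mul_sq_le_sq_mul_sq Finset.univ (fun p : σ × σ => (M ^ k) p.1 p.2)
    (fun p => w p.1 * w p.2)
  simp only [Fintype.sum_prod_type] at hcs
  have h1 : ∑ s, ∑ t, (M ^ k) s t * (w s * w t) = ∑ s, w s ^ 2 := by
    refine Finset.sum_congr rfl fun s _ => ?_
    have := congrFun hk s
    rw [Matrix.mulVec, dotProduct] at this
    conv_rhs => rw [sq, ← this, Finset.sum_mul]
    refine Finset.sum_congr rfl fun t _ => ?_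
    rw [← this]
    ring_nf
  have h2 : ∑ s, ∑ t, (w s * w t) ^ 2 = (∑ s, w s ^ 2) ^ 2 := by
    simp only [mul_pow]
    rw [sq, Finset.sum_mul_sum]
  rw [h1, h2] at hcs
  have : 0 < (∑ s, w s ^ 2) ^ 2 := by positivity
  exact le_of_mul_le_mul_right (by linarith) this

/-- By `hMg` and symmetry each entry satisfies `M s t ≤ g t / g s`. So the squared entries of a row
are dominated by `M s t * g t / g s`, whose row sum is at most `1`. -/
theorem trace_sq_le_card {M : Matrix σ σ ℝ} (hM : M.IsSymm) (hM0 : ∀ s t, 0 ≤ M s t)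
    (hg : ∀ s, 0 < g s) (hMg : ∀ s, ∑ t, M s t * g t ≤ g s) :
    (M ^ (2 * 1)).trace ≤ Fintype.card σ := by
  rw [trace_pow_two_mul hM, pow_one]
  have h : ∀ s t, M s t * g t ≤ g s := fun s t =>
    (Finset.single_le_sum (f := fun t => M s t * g t)
      (fun t _ => mul_nonneg (hM0 s t) (hg t).le) (Finset.mem_univ t)).trans (hMg s)
  rw [← nsmul_one, ← Finset.card_univ, ← Finset.sum_const]
  refine Finset.sum_le_sum fun s _ => ?_
  refine le_trans (Finset.sum_le_sum fun t _ => (?_ : M s t ^ 2 ≤ M s t * g t / g s)) ?_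
  · have h1 := h t s
    rw [hM.apply] at h1
    rw [le_div_iff₀ (hg s)]
    nlinarith [hM0 s t]
  · rw [← Finset.sum_div, div_le_one (hg s)]
    exact hMg s

/-- If the labels of all closed walks of lengths `4, 6, …, 2 k` collide, then the probability `η`
that a given label occurs in a step cannot be too small. -/
theorem one_le_of_forall_conflict {κ : Type*} [Fintype κ] (hS : ∀ s c t, 0 ≤ S s c t)
    (hM : (stepMatrix S).IsSymm) (hg : ∀ s, 0 < g s) {lab : κ → σ → V → V}
    (hη : ∀ α q t, ∑ s, labelledStepMatrix S (lab α) q s t * g s ≤ η * g t) (hη0 : 0 ≤ η)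
    (hMg : ∀ s, ∑ t, stepMatrix S s t * g t ≤ g s) {w : σ → ℝ} (hw : w ≠ 0)
    (hMw : stepMatrix S *ᵥ w = w) {k : ℕ} (hk : 1 ≤ k)
    (hconf : ∀ n j, 2 ≤ j → j ≤ k → n + 1 = 2 * j →
      ∀ (f : Fin (n + 1) → σ) (c : Fin (n + 1) → V), walkWeight S f c ≠ 0 →
      ∃ i l, i ≠ l ∧ ∃ α β, lab α (f i) (c i) = lab β (f l) (c l)) :
    1 ≤ ((4 * k ^ 2 * Fintype.card κ ^ 2) ^ 2 * η) ^ (k - 1) * Fintype.card σ := by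
  set A : ℝ := (4 * k ^ 2 * Fintype.card κ ^ 2) ^ 2 * η
  have hA : 0 ≤ A := by positivity
  have key : ∀ j, j + 1 ≤ k →
      (stepMatrix S ^ (2 * (j + 1))).trace ≤ A ^ j * Fintype.card σ := by
    intro j
    induction j with
    | zero =>
      intro _
      rw [pow_zero, one_mul]
      refine trace_sq_le_card hM (fun s t => ?_) hg hMg
      simp only [stepMatrix, Matrix.of_apply]
      exact Finset.sum_nonneg fun c _ => hS _ _ _
    | succ j ih =>
      intro hj
      have h1 := trace_pow_le_of_forall_conflict hS hM hg hη hη0 hMg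
        (n := 2 * j + 3) (j := j + 1 + 1) (by ring)
        (hconf (2 * j + 3) (j + 1 + 1) (by omega) hj (by ring))
      have ht'0 : 0 ≤ (stepMatrix S ^ (2 * (j + 1))).trace := by
        rw [trace_pow_two_mul hM]
        exact Finset.sum_nonneg fun _ _ => Finset.sum_nonneg fun _ _ => sq_nonneg _
      rw [Nat.add_sub_cancel] at h1
      have hjk : ((j + 1 + 1 : ℕ) : ℝ) ≤ k := by exact_mod_cast hj
      calc _ ≤ _ := h1
        _ ≤ A * (stepMatrix S ^ (2 * (j + 1))).trace := by
          refine mul_le_mul_of_nonneg_right ?_ ht'0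
          exact mul_le_mul_of_nonneg_right (by gcongr) hη0
        _ ≤ A * (A ^ j * Fintype.card σ) := mul_le_mul_of_nonneg_left (ih (by omega)) hA
        _ = _ := by ring
  have h1 := key (k - 1) (by omega)
  rw [Nat.sub_add_cancel hk] at h1
  exact (one_le_trace_pow_two_mul hM hw hMw k).trans h1

end LabelledWalks

/-! ### The walk on ordered pairs of vertices. -/

section TriangleWalks

open Matrix

variable {V : Type*} [Fintype V]

/-- The degree of a pair with respect to the weights `e` of the triples. -/
def pairDegree (e : V → V → V → ℝ) (a b : V) : ℝ := ∑ c, e a b c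

/-- The weight of the step from the pair `(x, y)` to the pair `(u, v)` along the triples
`x y c`, `y c v` and `c v u`. -/
noncomputable def rawStep (e : V → V → V → ℝ) (s : V × V) (c : V) (t : V × V) : ℝ :=
  e s.1 s.2 c * e s.2 c t.2 * e c t.2 t.1 / (pairDegree e s.2 c * pairDegree e c t.2)

/-- The square root of the degree of a pair, made positive. -/
noncomputable def sqrtDegree (e : V → V → V → ℝ) (s : V × V) : ℝ :=
  √(max (pairDegree e s.1 s.2) 1)

/-- The symmetric normalization of `rawStep`. -/
noncomputable def normStep (e : V → V → V → ℝ) (s : V × V) (c : V) (t : V × V) : ℝ :=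
  rawStep e s c t / (sqrtDegree e s * sqrtDegree e t)

/-- The three vertices that a step contributes to a walk. -/
def stepVertex (κ : Fin 3) (s : V × V) (c : V) : V := ![s.1, s.2, c] κ

theorem sqrtDegree_pos (e : V → V → V → ℝ) (s : V × V) : 0 < sqrtDegree e s :=
  Real.sqrt_pos.2 (lt_max_of_lt_right one_pos)

theorem sqrtDegree_mul_self (e : V → V → V → ℝ) (s : V × V) :
    sqrtDegree e s * sqrtDegree e s = max (pairDegree e s.1 s.2) 1 :=
  Real.mul_self_sqrt (by positivity)

theorem sum_triple_div_le_one (e : V → V → V → ℝ) (a b : V) : ∑ c, e a b c / pairDegree e a b ≤ 1 := by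
  rw [← Finset.sum_div]
  exact div_self_le_one _

theorem rawStep_eq (e : V → V → V → ℝ) (x y c u v : V) : rawStep e (x, y) c (u, v) =
    e x y c * (e y c v / pairDegree e y c) * (e c v u / pairDegree e c v) := by
  rw [rawStep]
  ring

theorem pairDegree_comm {e : V → V → V → ℝ} (hs : ∀ a b c, e a b c = e b a c) (a b : V) : pairDegree e a b = pairDegree e b a :=
  Finset.sum_congr rfl fun c _ => hs a b c

variable {e : V → V → V → ℝ} (he : ∀ a b c, e a b c = 0 ∨ e a b c = 1)
  (hr : ∀ a b c, e a b c = e b c a) (hs : ∀ a b c, e a b c = e b a c)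

include he

omit [Fintype V] in
theorem triple_nonneg (a b c : V) : 0 ≤ e a b c := by
  rcases he a b c with h | h <;> rw [h]
  exact zero_le_one

theorem triple_le_pairDegree (a b c : V) : e a b c ≤ pairDegree e a b :=
  Finset.single_le_sum (f := fun c => e a b c) (fun c _ => triple_nonneg he a b c)
    (Finset.mem_univ c)

theorem pairDegree_nonneg (a b : V) : 0 ≤ pairDegree e a b :=
  Finset.sum_nonneg fun c _ => triple_nonneg he a b c

theorem rawStep_nonneg (s : V × V) (c : V) (t : V × V) : 0 ≤ rawStep e s c t :=
  div_nonneg (mul_nonneg (mul_nonneg (triple_nonneg he _ _ _) (triple_nonneg he _ _ _))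
    (triple_nonneg he _ _ _)) (mul_nonneg (pairDegree_nonneg he _ _) (pairDegree_nonneg he _ _))

theorem normStep_nonneg (s : V × V) (c : V) (t : V × V) : 0 ≤ normStep e s c t :=
  div_nonneg (rawStep_nonneg he s c t)
    (mul_nonneg (sqrtDegree_pos e s).le (sqrtDegree_pos e t).le)

include hr

/-- The conditional weights sum to `1` only if the pair has positive degree, which the prefactor
guarantees whenever it is nonzero. -/
theorem triple_mul_sum (a b c : V) :
    e a b c * ∑ v, e b c v / pairDegree e b c = e a b c := by
  rcases he a b c with h | h
  · rw [h, zero_mul]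
  · have : 0 < pairDegree e b c := by
      have := triple_le_pairDegree he b c a
      rw [← hr, h] at this
      linarith
    rw [← Finset.sum_div]
    change _ * (pairDegree e b c / pairDegree e b c) = _
    rw [div_self this.ne', mul_one]

theorem sum_rawStep (s : V × V) : ∑ t, ∑ c, rawStep e s c t = pairDegree e s.1 s.2 := by
  obtain ⟨x, y⟩ := s
  rw [Finset.sum_comm, pairDegree]
  refine Finset.sum_congr rfl fun c _ => ?_
  rw [Fintype.sum_prod_type, Finset.sum_comm, ← triple_mul_sum he hr x y c, Finset.mul_sum]
  refine Finset.sum_congr rfl fun v _ => ?_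
  have h := triple_mul_sum he hr y c v
  simp only [rawStep_eq e]
  rw [← Finset.mul_sum, mul_assoc, div_mul_eq_mul_div, h]

include hs

-- A strip read backwards is again a strip: from `(u, v)` the triples are `uvc`, `vcy`, `cyx`. The
-- new state is written `(u, v)` rather than `(v, u)` for this reason.
omit he in
theorem rawStep_comm (s : V × V) (c : V) (t : V × V) : rawStep e s c t = rawStep e t c s := by
  rw [rawStep, rawStep, pairDegree_comm hs t.2 c, pairDegree_comm hs c s.2, hr t.1 t.2 c,
    hs t.2 c t.1, hs t.2 c s.2, ← hr s.2 c t.2, hs c s.2 s.1, ← hr s.1 s.2 c]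
  ring

omit he in
theorem normStep_comm (s : V × V) (c : V) (t : V × V) : normStep e s c t = normStep e t c s := by
  rw [normStep, normStep, rawStep_comm hr hs, mul_comm (sqrtDegree e s)]

omit he in
theorem stepMatrix_normStep_isSymm : (stepMatrix (normStep e)).IsSymm := by
  ext s t
  simp only [Matrix.transpose_apply, stepMatrix, Matrix.of_apply]
  exact Finset.sum_congr rfl fun c _ => normStep_comm hr hs t c s

omit he in
theorem rawStep_eq_backward (x y c u v : V) : rawStep e (x, y) c (u, v) =
    e u v c * (e v c y / pairDegree e v c) * (e c y x / pairDegree e c y) := by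
  rw [rawStep_comm hr hs, rawStep_eq e]

/-- Read backwards from `(u, v)`, the step chooses `c`, then `y`, then `x`. Each choice hits a
prescribed vertex `q` with conditional probability at most `η`, and the choices after it have total
weight at most `1`. -/
theorem sum_labelled_rawStep_le [DecidableEq V] {η : ℝ}
    (hη : ∀ a b c, e a b c ≤ η * pairDegree e a b) (hη0 : 0 ≤ η) (κ : Fin 3) (q : V)
    (t : V × V) : ∑ s, ∑ c, (if stepVertex κ s c = q then rawStep e s c t else 0) ≤
      η * pairDegree e t.1 t.2 := by
  obtain ⟨u, v⟩ := t
  have hp0 : ∀ a b c, 0 ≤ e a b c / pairDegree e a b := fun a b c =>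
    div_nonneg (triple_nonneg he _ _ _) (pairDegree_nonneg he _ _)
  have hp : ∀ a b c, e a b c / pairDegree e a b ≤ η := fun a b c => by
    rcases eq_or_lt_of_le (pairDegree_nonneg he a b) with h | h
    · rw [← h, div_zero]; exact hη0
    · rw [div_le_iff₀ h]; exact hη a b c
  simp only [Fintype.sum_prod_type, rawStep_eq_backward hr hs]
  fin_cases κ
  · change ∑ x, ∑ y, ∑ c, (if x = q then e u v c * (e v c y / pairDegree e v c) *
        (e c y x / pairDegree e c y) else 0) ≤ _
    rw [Fintype.sum_eq_single q fun x hx => by simp [hx]]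
    simp only [if_true]
    rw [Finset.sum_comm, pairDegree, Finset.mul_sum]
    refine Finset.sum_le_sum fun c _ => ?_
    calc ∑ y, e u v c * (e v c y / pairDegree e v c) * (e c y q / pairDegree e c y)
        ≤ ∑ y, e u v c * (e v c y / pairDegree e v c) * η := Finset.sum_le_sum fun y _ =>
          mul_le_mul_of_nonneg_left (hp _ _ _) (mul_nonneg (triple_nonneg he _ _ _) (hp0 _ _ _))
      _ = η * e u v c * ∑ y, e v c y / pairDegree e v c := by
          rw [Finset.mul_sum]
          exact Finset.sum_congr rfl fun y _ => by ring
      _ ≤ η * e u v c := mul_le_of_le_one_right (mul_nonneg hη0 (triple_nonneg he _ _ _))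
          (sum_triple_div_le_one e _ _)
  · change ∑ x, ∑ y, ∑ c, (if y = q then e u v c * (e v c y / pairDegree e v c) *
        (e c y x / pairDegree e c y) else 0) ≤ _
    rw [Finset.sum_comm, Fintype.sum_eq_single q fun y hy => by simp [hy]]
    simp only [if_true]
    rw [Finset.sum_comm, pairDegree, Finset.mul_sum]
    refine Finset.sum_le_sum fun c _ => ?_
    rw [← Finset.mul_sum]
    refine (mul_le_of_le_one_right (mul_nonneg (triple_nonneg he _ _ _) (hp0 _ _ _))
      (sum_triple_div_le_one e _ _)).trans ?_
    rw [mul_comm η]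
    exact mul_le_mul_of_nonneg_left (hp _ _ _) (triple_nonneg he _ _ _)
  · change ∑ x, ∑ y, ∑ c, (if c = q then e u v c * (e v c y / pairDegree e v c) *
        (e c y x / pairDegree e c y) else 0) ≤ _
    simp only [Finset.sum_ite_eq', Finset.mem_univ, if_true]
    rw [Finset.sum_comm]
    refine le_trans ?_ (hη u v q)
    have h : ∀ y, ∑ x, e u v q * (e v q y / pairDegree e v q) * (e q y x / pairDegree e q y) ≤
        e u v q * (e v q y / pairDegree e v q) := fun y => by
      rw [← Finset.mul_sum]
      exact mul_le_of_le_one_right (mul_nonneg (triple_nonneg he _ _ _) (hp0 _ _ _))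
        (sum_triple_div_le_one e _ _)
    refine (Finset.sum_le_sum fun y _ => h y).trans ?_
    rw [← Finset.mul_sum]
    exact mul_le_of_le_one_right (triple_nonneg he _ _ _) (sum_triple_div_le_one e _ _)

theorem sum_labelledStepMatrix_normStep_le [DecidableEq V] {η : ℝ}
    (hη : ∀ a b c, e a b c ≤ η * pairDegree e a b) (hη0 : 0 ≤ η) (κ : Fin 3) (q : V)
    (t : V × V) : ∑ s, labelledStepMatrix (normStep e) (stepVertex κ) q s t * sqrtDegree e s ≤
      η * sqrtDegree e t := by
  have ht := sqrtDegree_pos e t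
  have h : ∑ s, labelledStepMatrix (normStep e) (stepVertex κ) q s t * sqrtDegree e s =
      (∑ s, ∑ c, (if stepVertex κ s c = q then rawStep e s c t else 0)) / sqrtDegree e t := by
    rw [Finset.sum_div]
    refine Finset.sum_congr rfl fun s _ => ?_
    simp only [labelledStepMatrix, Matrix.of_apply]
    rw [Finset.sum_mul, Finset.sum_div]
    refine Finset.sum_congr rfl fun c _ => ?_
    have hs' := sqrtDegree_pos e s
    rw [normStep]
    split_ifs
    · field_simp
    · simp
  rw [h, div_le_iff₀ ht, mul_assoc, sqrtDegree_mul_self]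
  exact (sum_labelled_rawStep_le he hr hs hη hη0 κ q t).trans
    (mul_le_mul_of_nonneg_left (le_max_left _ _) hη0)

omit hs

theorem sum_normStep_mul_sqrtDegree (s : V × V) :
    ∑ t, stepMatrix (normStep e) s t * sqrtDegree e t =
      pairDegree e s.1 s.2 / sqrtDegree e s := by
  rw [← sum_rawStep he hr, Finset.sum_div]
  refine Finset.sum_congr rfl fun t _ => ?_
  simp only [stepMatrix, Matrix.of_apply]
  rw [Finset.sum_mul, Finset.sum_div]
  refine Finset.sum_congr rfl fun c _ => ?_
  have hs' := sqrtDegree_pos e s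
  have ht := sqrtDegree_pos e t
  rw [normStep]
  field_simp

theorem sum_normStep_le (s : V × V) :
    ∑ t, stepMatrix (normStep e) s t * sqrtDegree e t ≤ sqrtDegree e s := by
  rw [sum_normStep_mul_sqrtDegree he hr, div_le_iff₀ (sqrtDegree_pos e s), sqrtDegree_mul_self]
  exact le_max_left _ _

include hs

/-- The vector is the square root of the degree where the degree is at least `1`, and the truncation
in `sqrtDegree` is inactive there. Steps into a pair have nonzero weight only if the pair lies in a
triple, so the remaining pairs do not contribute. -/
theorem stepMatrix_mulVec_degree :
    stepMatrix (normStep e) *ᵥ (fun s => pairDegree e s.1 s.2 / sqrtDegree e s) =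
      fun s => pairDegree e s.1 s.2 / sqrtDegree e s := by
  ext s
  rw [← sum_normStep_mul_sqrtDegree he hr, Matrix.mulVec, dotProduct]
  refine Finset.sum_congr rfl fun t _ => ?_
  simp only [stepMatrix, Matrix.of_apply]
  rw [Finset.sum_mul, Finset.sum_mul]
  refine Finset.sum_congr rfl fun c _ => ?_
  have ht := sqrtDegree_pos e t
  rcases he c t.2 t.1 with h | h
  · simp [normStep, rawStep, h]
  · have h1 : 1 ≤ pairDegree e t.1 t.2 := by
      have := triple_le_pairDegree he t.1 t.2 c
      rw [hs, ← hr, h] at this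
      exact this
    rw [← max_eq_left h1, ← sqrtDegree_mul_self, mul_div_cancel_right₀ _ ht.ne']

end TriangleWalks

/-! ### Cleaning the hypergraph and turning walks into cycles. -/

section Hypergraph

variable {V : Type*} [Fintype V] [DecidableEq V]

/-- The number of edges of `H` that contain two given vertices. -/
def codegree (H : Finset (Finset V)) (a b : V) : ℕ :=
  (Finset.univ.filter fun c => ({a, b, c} : Finset V) ∈ H).card

/-- The ordered pairs of vertices that lie in an edge of `H`. -/
def shadowPairs (H : Finset (Finset V)) : Finset (V × V) :=
  Finset.univ.filter fun p => 0 < codegree H p.1 p.2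

theorem codegree_mono {H H' : Finset (Finset V)} (h : H ⊆ H') (a b : V) :
    codegree H a b ≤ codegree H' a b :=
  Finset.card_le_card (Finset.monotone_filter_right _ fun _ _ hc => h hc)

theorem card_filter_le_codegree {H : Finset (Finset V)} (hH : (H : Set (Finset V)).Sized 3)
    {a b : V} (hab : a ≠ b) : (H.filter fun e => a ∈ e ∧ b ∈ e).card ≤ codegree H a b := by
  refine (Finset.card_le_card (t := (Finset.univ.filter fun c => ({a, b, c} : Finset V) ∈ H).image
    fun c => ({a, b, c} : Finset V)) ?_).trans Finset.card_image_le
  intro e he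
  rw [Finset.mem_filter] at he
  obtain ⟨heH, ha, hb⟩ := he
  have hsub : ({a, b} : Finset V) ⊆ e := by
    intro x hx
    rw [Finset.mem_insert, Finset.mem_singleton] at hx
    rcases hx with rfl | rfl <;> assumption
  have hcard : (e \ {a, b}).card = 1 := by
    rw [Finset.card_sdiff_of_subset hsub, hH heH, Finset.card_pair hab]
  obtain ⟨c, hc⟩ := Finset.card_eq_one.1 hcard
  have hec : ({a, b, c} : Finset V) = e := by
    rw [← Finset.sdiff_union_of_subset hsub, hc]
    ext x
    simp only [Finset.mem_insert, Finset.mem_singleton, Finset.mem_union]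
    tauto
  rw [Finset.mem_image]
  exact ⟨c, by simp [hec, heH], hec⟩

/-- A dense hypergraph contains one in which all pairs in the shadow have large codegree. -/
theorem exists_subhypergraph_codegree_ge {H : Finset (Finset V)}
    (hH : (H : Set (Finset V)).Sized 3) {D : ℝ} (hD0 : 0 ≤ D)
    (hD : D * (Fintype.card V : ℝ) ^ 2 < H.card) :
    ∃ H' ⊆ H, H'.Nonempty ∧ ∀ a b c, ({a, b, c} : Finset V) ∈ H' → D ≤ codegree H' a b := by
  -- Maximizing edges minus `D` times shadow pairs. The value at `H` is positive, so a maximizer is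
  -- nonempty. Deleting all edges through a shadow pair of codegree below `D` would lose fewer than
  -- `D` edges and at least one shadow pair, increasing the value.
  obtain ⟨H', hH', hmax⟩ := Finset.exists_max_image H.powerset
    (fun G => (G.card : ℝ) - D * (shadowPairs G).card) ⟨H, Finset.mem_powerset_self H⟩
  rw [Finset.mem_powerset] at hH'
  refine ⟨H', hH', ?_, ?_⟩
  · rw [Finset.nonempty_iff_ne_empty]
    rintro rfl
    have h := hmax H (Finset.mem_powerset_self H)
    have hsh : ((shadowPairs H).card : ℝ) ≤ (Fintype.card V : ℝ) ^ 2 := by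
      have : (shadowPairs H).card ≤ Fintype.card (V × V) := Finset.card_le_univ _
      rw [Fintype.card_prod, ← sq] at this
      exact_mod_cast this
    have h2 : D * (shadowPairs H).card ≤ D * (Fintype.card V : ℝ) ^ 2 :=
      mul_le_mul_of_nonneg_left hsh hD0
    have h3 : 0 ≤ D * ((shadowPairs (∅ : Finset (Finset V))).card : ℝ) := by positivity
    simp only [Finset.card_empty, Nat.cast_zero] at h
    linarith
  · intro a b c habc
    by_contra! hlt
    have hab : a ≠ b := by
      rintro rfl
      have h3 := hH (hH' habc)
      rw [Finset.insert_eq_of_mem (by simp)] at h3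
      have := Finset.card_le_two (a := a) (b := c)
      omega
    set G := H' \ H'.filter fun e => a ∈ e ∧ b ∈ e with hG
    have hGH : G ⊆ H' := Finset.sdiff_subset
    have h := hmax G (Finset.mem_powerset.2 (hGH.trans hH'))
    have hcard : (H'.card : ℝ) ≤ codegree H' a b + G.card := by
      have h1 := Finset.card_sdiff_add_card_eq_card
        (Finset.filter_subset (fun e => a ∈ e ∧ b ∈ e) H')
      rw [← hG] at h1
      have h2 := card_filter_le_codegree (hH.mono (Finset.coe_subset.2 hH')) hab
      have : H'.card ≤ codegree H' a b + G.card := by omega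
      exact_mod_cast this
    have hsh : ((shadowPairs G).card : ℝ) + 1 ≤ (shadowPairs H').card := by
      have hss : shadowPairs G ⊂ shadowPairs H' := by
        refine Finset.ssubset_iff_of_subset ?_ |>.2 ⟨(a, b), ?_, ?_⟩
        · intro p hp
          simp only [shadowPairs, Finset.mem_filter, Finset.mem_univ, true_and] at hp ⊢
          exact hp.trans_le (codegree_mono hGH _ _)
        · simp only [shadowPairs, Finset.mem_filter, Finset.mem_univ, true_and]
          exact Finset.card_pos.2 ⟨c, by simpa using habc⟩
        · intro hp
          obtain ⟨x, hx⟩ := Finset.card_pos.1 (Finset.mem_filter.1 hp).2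
          have hxG := Finset.mem_sdiff.1 (Finset.mem_filter.1 hx).2
          exact hxG.2 (Finset.mem_filter.2 ⟨hxG.1, by simp, by simp⟩)
      exact_mod_cast Finset.card_lt_card hss
    have : D * (((shadowPairs G).card : ℝ) + 1) ≤ D * (shadowPairs H').card :=
      mul_le_mul_of_nonneg_left hsh hD0
    linarith

/-- The indicator function of the edges of `H`. -/
def edgeIndicator (H : Finset (Finset V)) (a b c : V) : ℝ :=
  if ({a, b, c} : Finset V) ∈ H then 1 else 0

theorem pairDegree_edgeIndicator (H : Finset (Finset V)) (a b : V) :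
    pairDegree (edgeIndicator H) a b = codegree H a b := by
  simp [pairDegree, edgeIndicator, codegree]

omit [Fintype V] in
theorem edgeIndicator_rotate (H : Finset (Finset V)) (a b c : V) :
    edgeIndicator H a b c = edgeIndicator H b c a := by
  have : ({a, b, c} : Finset V) = {b, c, a} := by
    rw [Finset.insert_comm, Finset.pair_comm a c]
  rw [edgeIndicator, edgeIndicator, this]

omit [Fintype V] in
theorem edgeIndicator_swap (H : Finset (Finset V)) (a b c : V) :
    edgeIndicator H a b c = edgeIndicator H b a c := by
  rw [edgeIndicator, edgeIndicator, Finset.insert_comm]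

omit [Fintype V] in
theorem edgeIndicator_eq_zero_or_one (H : Finset (Finset V)) (a b c : V) :
    edgeIndicator H a b c = 0 ∨ edgeIndicator H a b c = 1 := by
  rw [edgeIndicator]
  split_ifs <;> simp

omit [Fintype V] in
theorem mem_of_edgeIndicator_ne_zero {H : Finset (Finset V)} {a b c : V}
    (h : edgeIndicator H a b c ≠ 0) : ({a, b, c} : Finset V) ∈ H := by
  by_contra hmem
  exact h (if_neg hmem)

/-- A closed walk of even length at least `4` without repeated vertices is a torus-like cycle. -/
theorem exists_isTorusLike_of_walk {H : Finset (Finset V)} (hH : (H : Set (Finset V)).Sized 3)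
    {n j : ℕ} (hj : 2 ≤ j) (hn : n + 1 = 2 * j) {f : Fin (n + 1) → V × V} {c : Fin (n + 1) → V}
    (hw : walkWeight (normStep (edgeIndicator H)) f c ≠ 0)
    (hinj : ∀ i l, i ≠ l → ∀ α β, stepVertex α (f i) (c i) ≠ stepVertex β (f l) (c l)) :
    ∃ C ⊆ H, IsTorusLike C ∧ C.card = 6 * j := by
  have hstep : ∀ i, ({(f i).1, (f i).2, c i} : Finset V) ∈ H ∧
      ({(f i).2, c i, (f (i + 1)).2} : Finset V) ∈ H ∧
      ({c i, (f (i + 1)).2, (f (i + 1)).1} : Finset V) ∈ H := by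
    intro i
    have h := (Finset.prod_ne_zero_iff.1 hw) i (Finset.mem_univ i)
    have h1 : edgeIndicator H (f i).1 (f i).2 (c i) * edgeIndicator H (f i).2 (c i) (f (i + 1)).2 *
        edgeIndicator H (c i) (f (i + 1)).2 (f (i + 1)).1 ≠ 0 := by
      intro h0
      exact h (by rw [normStep, rawStep, h0, zero_div, zero_div])
    rw [mul_ne_zero_iff, mul_ne_zero_iff] at h1
    exact ⟨mem_of_edgeIndicator_ne_zero h1.1.1, mem_of_edgeIndicator_ne_zero h1.1.2,
      mem_of_edgeIndicator_ne_zero h1.2⟩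
  let vert : Fin 3 → ZMod (n + 1) → V := fun α i => stepVertex α (f i) (c i)
  have hv : Function.Injective2 vert := by
    intro α β i l h
    have hil : i = l := by
      by_contra hil
      exact hinj i l hil α β h
    subst hil
    refine ⟨?_, rfl⟩
    -- Inside a single step the three vertices are distinct because they form an edge of size `3`.
    have hinj : Function.Injective ![(f i).1, (f i).2, c i] := by
      have hc := hH (hstep i).1
      have himg : (Finset.univ.image ![(f i).1, (f i).2, c i]) = {(f i).1, (f i).2, c i} := by
        ext x
        simp [Fin.exists_fin_succ, eq_comm]
      rw [← himg] at hc
      have hon := Finset.card_image_iff.1 (hc.trans (Finset.card_fin 3).symm)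
      rwa [Finset.coe_univ, Set.injOn_univ] at hon
    exact hinj h
  refine ⟨cylinderComplex vert, ?_, ?_, ?_⟩
  · intro e he
    obtain ⟨⟨κ, i⟩, -, rfl⟩ := Finset.mem_image.1 he
    fin_cases κ
    · exact (hstep i).1
    · exact (hstep i).2.1
    · exact (hstep i).2.2
  · exact isTorusLike_cylinderComplex (by omega) ⟨j, by omega⟩ hv
  · rw [card_cylinderComplex (by omega) hv]
    omega

/-- Codegrees cannot be large in a hypergraph without short torus-like cycles. -/
theorem one_le_of_forall_not_isTorusLike {H : Finset (Finset V)} (hH : (H : Set (Finset V)).Sized 3)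
    (hne : H.Nonempty) {D : ℝ} (hD0 : 0 < D)
    (hD : ∀ a b c, ({a, b, c} : Finset V) ∈ H → D ≤ codegree H a b) {k : ℕ} (hk : 1 ≤ k)
    (hC : ∀ C ⊆ H, IsTorusLike C → ¬ C.card ≤ 6 * k) :
    1 ≤ ((36 * (k : ℝ) ^ 2) ^ 2 / D) ^ (k - 1) * (Fintype.card V : ℝ) ^ 2 := by
  have he := edgeIndicator_eq_zero_or_one H
  have hr := edgeIndicator_rotate H
  have hs := edgeIndicator_swap H
  have hη : ∀ a b c, edgeIndicator H a b c ≤ D⁻¹ * pairDegree (edgeIndicator H) a b := by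
    intro a b c
    rw [pairDegree_edgeIndicator, edgeIndicator]
    split_ifs with h
    · rw [inv_mul_eq_div, le_div_iff₀ hD0, one_mul]
      exact hD a b c h
    · positivity
  have hw : (fun s : V × V => pairDegree (edgeIndicator H) s.1 s.2 /
      sqrtDegree (edgeIndicator H) s) ≠ 0 := by
    obtain ⟨e, heH⟩ := hne
    obtain ⟨a, b, c, -, -, -, rfl⟩ := Finset.card_eq_three.1 (hH heH)
    intro h0
    have h1 := congrFun h0 (a, b)
    have h2 := hD a b c heH
    rw [← pairDegree_edgeIndicator] at h2
    exact (div_pos (hD0.trans_le h2) (sqrtDegree_pos _ (a, b))).ne' h1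
  have hmain := one_le_of_forall_conflict (k := k) (lab := stepVertex) (normStep_nonneg he)
    (stepMatrix_normStep_isSymm hr hs) (sqrtDegree_pos _)
    (sum_labelledStepMatrix_normStep_le he hr hs hη (inv_nonneg.2 hD0.le))
    (inv_nonneg.2 hD0.le) (sum_normStep_le he hr) hw (stepMatrix_mulVec_degree he hr hs) hk ?_
  · refine hmain.trans (le_of_eq ?_)
    -- Three label functions turn `4 k² · 3²` into `36 k²`, and the states are the ordered pairs.
    rw [Fintype.card_prod, Fintype.card_fin]
    push_cast
    rw [div_eq_mul_inv]
    congr 1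
    · ring
    · ring
  · intro n j hj hjk hn f c hfc
    by_contra! hcon
    obtain ⟨C, hCH, hCt, hcard⟩ := exists_isTorusLike_of_walk hH hj hn hfc hcon
    exact hC C hCH hCt (by omega)

end Hypergraph

/-! ### Choice of the codegree threshold and the final bound. -/

theorem card_le_of_forall_not_isTorusLike {V : Type*} [Fintype V] {k : ℕ} (hk : 2 ≤ k)
    {H : Finset (Finset V)} (hH : (H : Set (Finset V)).Sized 3)
    (hC : ∀ C ⊆ H, IsTorusLike C → ¬ C.card ≤ 6 * k) :
    (H.card : ℝ) ≤ ((36 * (k : ℝ) ^ 2) ^ 2 + 1) *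
      (Fintype.card V : ℝ) ^ (2 + 2 / ((k : ℝ) - 1)) := by
  classical
  rcases H.eq_empty_or_nonempty with rfl | ⟨e, he⟩
  · simp only [Finset.card_empty, Nat.cast_zero]
    positivity
  by_contra! hlt
  set n : ℝ := (Fintype.card V : ℝ) with hn
  have hn0 : 0 < n := by
    have h1 := hH he
    have h2 := Finset.card_le_univ e
    rw [hn]
    exact_mod_cast (by omega : 0 < Fintype.card V)
  have hk1 : (1 : ℝ) ≤ (k : ℝ) - 1 := by
    have : (2 : ℝ) ≤ k := by exact_mod_cast hk
    linarith
  set A : ℝ := (36 * (k : ℝ) ^ 2) ^ 2 with hA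
  have hA0 : 0 ≤ A := by positivity
  -- The power of `n` is chosen so that `D ^ (k - 1)` cancels the `n ^ 2` states. The factor `A + 1`
  -- instead of `A` leaves `(A / (A + 1)) ^ (k - 1) < 1`, contradicting the lower bound `1`.
  set D : ℝ := (A + 1) * n ^ (2 / ((k : ℝ) - 1)) with hD
  have hD0 : 0 < D := by positivity
  have hDn : D * n ^ 2 < H.card := by
    refine lt_of_eq_of_lt ?_ hlt
    rw [hD, Real.rpow_add hn0, ← Real.rpow_natCast n 2]
    push_cast
    ring
  obtain ⟨H', hH', hne, hdeg⟩ := exists_subhypergraph_codegree_ge hH hD0.le hDn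
  have h := one_le_of_forall_not_isTorusLike (hH.mono (Finset.coe_subset.2 hH')) hne hD0 hdeg (k := k) (by omega)
    fun C hCH => hC C (hCH.trans hH')
  rw [← hA, ← hn, hD, div_mul_eq_div_div, div_pow] at h
  have hpow : (n ^ (2 / ((k : ℝ) - 1))) ^ (k - 1) = n ^ 2 := by
    rw [← Real.rpow_natCast, ← Real.rpow_mul hn0.le, Nat.cast_sub (by omega), Nat.cast_one,
      div_mul_cancel₀ _ (by linarith)]
    exact_mod_cast Real.rpow_natCast n 2
  rw [hpow, div_mul_cancel₀ _ (by positivity)] at h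
  have hlt1 : A / (A + 1) < 1 := by
    rw [div_lt_one (by positivity)]
    linarith
  exact absurd h (not_le.2 (pow_lt_one₀ (by positivity) hlt1 (by omega)))

theorem theorem4 (k : ℕ) (hk : 2 ≤ k) :
    ∃ δ : ℕ → ℝ, Filter.Tendsto δ Filter.atTop (nhds 0) ∧
      ∀ (n : ℕ) (V : Type*) [Fintype V], Fintype.card V = n →
        ∀ H : Finset (Finset V), (H : Set (Finset V)).Sized 3 →
          (∀ C ⊆ H, IsTorusLike C → ¬ C.card ≤ 6 * k) →
            (H.card : ℝ) ≤ (n : ℝ) ^ (2 + 2 / ((k : ℝ) - 1) + δ n) := by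
  set A : ℝ := (36 * (k : ℝ) ^ 2) ^ 2 + 1 with hA
  have hA0 : 0 < A := by positivity
  -- For `n ≥ 2` this exponent satisfies `n ^ δ n = A`, absorbing the constant. Smaller `n` do not
  -- matter, since a nonempty `H` forces `n ≥ 3`.
  refine ⟨fun n => Real.log A / Real.log n, ?_, ?_⟩
  · exact (Real.tendsto_log_atTop.comp tendsto_natCast_atTop_atTop).const_div_atTop _
  intro n V _ hn H hH hC
  rcases H.eq_empty_or_nonempty with rfl | ⟨e, he⟩
  · simp only [Finset.card_empty, Nat.cast_zero]
    positivity
  have hn3 : (3 : ℝ) ≤ n := by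
    have h1 := hH he
    have h2 := Finset.card_le_univ e
    exact_mod_cast (by omega : 3 ≤ n)
  have hlog : Real.log n ≠ 0 := (Real.log_pos (by linarith)).ne'
  refine (card_le_of_forall_not_isTorusLike hk hH hC).trans (le_of_eq ?_)
  rw [hn, Real.rpow_add (by linarith : (0 : ℝ) < n) (2 + 2 / ((k : ℝ) - 1)),
    Real.rpow_def_of_pos (by linarith) (Real.log A / Real.log n), mul_div_cancel₀ _ hlog,
    Real.exp_log hA0, mul_comm]
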